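/- Let $\nu>0$ and $0<T<\infty$. Let $u:(0,T)\times\mathbb R^3\to\mathbb R^3$ (measurable, in $L^2_{loc}$) and $p:(0,T)\times\mathbb R^3\to\mathbb R$ (in $L^1_{loc}$) solve the incompressible Navier–Stokes equations $$\partial_t u+u\cdot\nabla u-\nu\Delta u+\nabla p=0,\qquad \nabla\cdot u=0$$ in the sense of distributions on $(0,T)\times\mathbb R^3$ (with $u\cdot\nabla u=\nabla\cdot(u\otimes u)$). The pressure, which the equations determine only up to a function of time, is normalized to vanish at infinity: for almost every $t$ and every $x\in\mathbb R^3$, the average of $p(t,\cdot)$ over the ball $B(x,R)$ tends to $0$ as $R\to\infty$. Let $0<\alpha\le 1$ and $1\le q\le\infty$, and assume $u\in L^\infty(0,T;L^2(\mathbb R^3))\cap L^{2q}(0,T;C^\alpha(\mathbb R^3))$. Then: 1. if $\alpha<\frac12$, then $p\in L^q(0,T;C^{2\alpha}(\mathbb R^3))$; 2. if $\alpha=\frac12$, then $p\in L^q(0,T;LiplogLip)$, where $LiplogLip$ is the space of bounded functions with modulus of continuity $|x-y|\log(|x-y|^{-1})$; 3. if $\alpha>\frac12$, then $p\in L^q(0,T;Lip)$,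 where $Lip$ is the space of bounded Lipschitz functions on $\mathbb R^3$. Here the norm of $C^\gamma(\mathbb R^3)$, $0<\gamma\le1$, is $\sup|f|+\sup_{x\ne y}|f(x)-f(y)|/|x-y|^\gamma$; the norm of $LiplogLip$ is $\sup|f|+\sup_{0<|x-y|\le 1/2}|f(x)-f(y)|/(|x-y|\log(|x-y|^{-1}))$; the norm of $Lip$ is $\sup|f|+\sup_{x\neq y}|f(x)-f(y)|/|x-y|$. A function $f$ belongs to $L^r(0,T;X)$ if, after modification of $f(t,\cdot)$ on a null set of $\mathbb R^3$ for almost every $t$, the function $t\mapsto\|f(t,\cdot)\|_X$ is (measurable and) in $L^r(0,T)$. -/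

import Mathlib

open MeasureTheory Set Filter Topology
open scoped ENNReal NNReal ContDiff

/-- Three-dimensional Euclidean space. -/
abbrev E3 : Type := EuclideanSpace ℝ (Fin 3)

/-- The space-time slab `(0,T) × ℝ³`. -/
def slab (T : ℝ) : Set (ℝ × E3) := Ioo 0 T ×ˢ univ

/-- Smooth compactly supported test functions on the open slab `(0,T) × ℝ³`. -/
def IsTest {F : Type*} [NormedAddCommGroup F] [NormedSpace ℝ F] (T : ℝ)
    (φ : ℝ → E3 → F) : Prop :=
  ContDiff ℝ ∞ (Function.uncurry φ) ∧ HasCompactSupport (Function.uncurry φ) ∧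
    tsupport (Function.uncurry φ) ⊆ slab T

/-- The divergence of a vector field on `ℝ³`. -/
noncomputable def divergence (f : E3 → E3) (x : E3) : ℝ :=
  ∑ i : Fin 3, fderiv ℝ f x (EuclideanSpace.single i 1) i

/-- `(u, p)` solves, in the sense of distributions on `(0,T) × ℝ³`, the incompressible
Navier-Stokes equations `∂ₜu + u·∇u - ν Δu + ∇p = 0`, `∇·u = 0`.
In the momentum equation `⟪u, (Dφ) u⟫ = ∑ i j, uᵢ uⱼ ∂ⱼφᵢ`. -/
structure IsNavierStokesSolution (ν T : ℝ) (u : ℝ → E3 → E3) (p : ℝ → E3 → ℝ) : Prop where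
  measurable_velocity :
    AEStronglyMeasurable (Function.uncurry u) (volume.restrict (slab T))
  locally_square_integrable :
    LocallyIntegrableOn (fun z : ℝ × E3 => ‖u z.1 z.2‖ ^ 2) (slab T) volume
  pressure_locally_integrable :
    LocallyIntegrableOn (Function.uncurry p) (slab T) volume
  momentum : ∀ φ : ℝ → E3 → E3, IsTest T φ →
    ∫ z in slab T,
      (inner ℝ (u z.1 z.2) (deriv (fun s => φ s z.2) z.1)
        + inner ℝ (u z.1 z.2) (fderiv ℝ (φ z.1) z.2 (u z.1 z.2))
        + ν * inner ℝ (u z.1 z.2) (Laplacian.laplacian (φ z.1) z.2)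
        + p z.1 z.2 * divergence (φ z.1) z.2) = 0
  divergence_free : ∀ ψ : ℝ → E3 → ℝ, IsTest T ψ →
    ∫ z in slab T, inner ℝ (u z.1 z.2) (gradient (ψ z.1) z.2) = 0

/-- Normalization of the pressure, which the equations determine only up to a function of time:
for almost every time, the averages of the pressure over large balls tend to zero. -/
def PressureVanishesAtInfinity (T : ℝ) (p : ℝ → E3 → ℝ) : Prop :=
  ∀ᵐ t ∂(volume.restrict (Ioo 0 T)), ∀ x : E3,
    Tendsto (fun R : ℝ => ⨍ y in Metric.ball x R, p t y) atTop (𝓝 0)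

/-- The supremum norm, with values in `[0,∞]`. -/
noncomputable def supNorm {F : Type*} [NormedAddCommGroup F] (f : E3 → F) : ℝ≥0∞ :=
  ⨆ x, ‖f x‖ₑ

/-- The norm of `C^γ(ℝ³)`, `0 < γ ≤ 1`: supremum norm plus Hölder seminorm. -/
noncomputable def holderFullNorm {F : Type*} [NormedAddCommGroup F] (γ : ℝ≥0)
    (f : E3 → F) : ℝ≥0∞ :=
  supNorm f + eHolderNorm γ f

/-- The norm of the space of bounded Lipschitz functions on `ℝ³`. -/
noncomputable def lipFullNorm {F : Type*} [NormedAddCommGroup F] (f : E3 → F) : ℝ≥0∞ :=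
  supNorm f + ⨅ (C : ℝ≥0) (_ : LipschitzWith C f), (C : ℝ≥0∞)

/-- `f` has the modulus of continuity `C |x-y| log(1/|x-y|)` at small distances.
(The expression `r log(1/r)` vanishes at `r = 1`, so it is a modulus only for small `r`;
for bounded functions the threshold `1/2` is immaterial.) -/
def LogLipschitzWith {F : Type*} [NormedAddCommGroup F] (C : ℝ≥0) (f : E3 → F) : Prop :=
  ∀ x y : E3, 0 < dist x y → dist x y ≤ 1 / 2 →
    dist (f x) (f y) ≤ C * (dist x y * Real.log (1 / dist x y))

/-- The norm of the space of bounded log-Lipschitz functions on `ℝ³`. -/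
noncomputable def logLipFullNorm {F : Type*} [NormedAddCommGroup F] (f : E3 → F) : ℝ≥0∞ :=
  supNorm f + ⨅ (C : ℝ≥0) (_ : LogLipschitzWith C f), (C : ℝ≥0∞)

/-- `f ∈ L^r(0,T; X)`, where `X` is the space of functions on `ℝ³` on which `N` is finite:
after modification of `f(t,·)` on a null set for almost every `t`, the function
`t ↦ N (f(t,·))` is in `L^r(0,T)` (in particular measurable and almost everywhere finite). -/
def MemTimeLp {F : Type*} [NormedAddCommGroup F] (N : (E3 → F) → ℝ≥0∞) (r : ℝ≥0∞) (T : ℝ)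
    (f : ℝ → E3 → F) : Prop :=
  ∃ g : ℝ → E3 → F, (∀ᵐ t ∂(volume.restrict (Ioo 0 T)), g t =ᵐ[volume] f t) ∧
    MemLp (fun t => N (g t)) r (volume.restrict (Ioo 0 T))

/-! For almost every time the pressure solves `-Δp = ∂ᵢ∂ⱼ(uᵢuⱼ)` weakly: a test field `χ(t)∇ψ` in
the momentum equation turns the time derivative and the viscous term into gradients tested against
`u`, and these vanish because `u` is divergence free (`ae_integral_hessian`). Everything else
happens at fixed time, with no singular integrals.

Let `Ψ` be a compactly supported function with `ΔΨ = h(|z|) - h(|z|/2)/8`, where the profile `h` has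
nonzero integral (`exists_kernel`). Testing with `Ψ((y-x)/r)` expresses the difference of the
`h`-weighted means of `p` at scales `r` and `2r` through the integral of `D²Ψ((y-x)/r)` against `u ⊗
u` (`radialMean_sub_eq`). As `r → ∞` the means tend to `0` by the normalization of the pressure; as
`r → 0` they tend to `(∫ h) p(x)` for almost every `x`. So `p` is a sum of dyadic increments.

An increment is estimated in two ways. At scales `r ≤ 1`, `div u = 0` and `∫ D²Ψ = 0` allow `u` to
be replaced by `u - u(x)`, so that the increment is `O([u]_α² r^{2α})`. At scales `r ≥ 1` the energy
gives `O(r⁻³ ‖u‖₂²)`. Moving the centre from `x` to `x'` gains a factor `|x-x'|/r`, because `D²Ψ` is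
Lipschitz; this is used when `r ≥ |x-x'|`, and the plain bound at finer scales. The result
(`exists_hasDyadicModulus`) is a modulus `|x-x'|^{2α} + |x-x'| Σ r^{2α-1} + |x-x'|` up to constants,
the sum being over dyadic `r` between `|x-x'|` and `1`. The sum is dominated by its smallest scale,
has about `log(1/|x-x'|)` equal terms, or converges, according as `α` is below, at or above `1/2`:
these are the three conclusions.

All bounds are linear in `[u(t)]_α² + ‖u(t)‖₂²`, hence `L^{2q}` in time for `u` becomes `L^q` for
`p`. -/

/-! ### From space-time identities to almost every time -/

/-- Integrability over `J × ℝ³` for every compact set of times `J ⊆ (0,T)`. -/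
def SliceIntegrable (T : ℝ) (f : ℝ → E3 → ℝ) : Prop :=
  ∀ J ⊆ Ioo 0 T, IsCompact J → IntegrableOn (Function.uncurry f) (J ×ˢ univ) volume

lemma volume_restrict_slab (T : ℝ) :
    (volume : Measure (ℝ × E3)).restrict (slab T) = (volume.restrict (Ioo 0 T)).prod volume := by
  rw [slab, Measure.volume_eq_prod, ← Measure.prod_restrict, Measure.restrict_univ]

lemma SliceIntegrable.integrable_mul {T : ℝ} {f : ℝ → E3 → ℝ} (hf : SliceIntegrable T f)
    {χ : ℝ → ℝ} (hχ : Continuous χ) (hc : HasCompactSupport χ) (hs : tsupport χ ⊆ Ioo 0 T) :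
    Integrable (fun z : ℝ × E3 => χ z.1 * f z.1 z.2) (volume.restrict (slab T)) := by
  obtain ⟨C, hC⟩ := hχ.bounded_above_of_compact_support hc
  have h1 : IntegrableOn (fun z : ℝ × E3 => χ z.1 * f z.1 z.2) (tsupport χ ×ˢ univ) volume :=
    Integrable.bdd_mul (c := C) (hf _ hs hc) (by fun_prop) (Eventually.of_forall fun z => hC z.1)
  have h2 : Integrable (fun z : ℝ × E3 => χ z.1 * f z.1 z.2) volume := by
    refine h1.integrable_of_forall_notMem_eq_zero fun z hz => ?_
    have : z.1 ∉ tsupport χ := fun h => hz ⟨h, mem_univ _⟩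
    simp [image_eq_zero_of_notMem_tsupport this]
  exact h2.restrict

/-- Fubini and the fundamental lemma of the calculus of variations in the time variable alone; the
spatial test function is already built into `f`. -/
lemma SliceIntegrable.ae_integral_eq_zero {T : ℝ} {f : ℝ → E3 → ℝ} (hf : SliceIntegrable T f)
    (h : ∀ χ : ℝ → ℝ, ContDiff ℝ ∞ χ → HasCompactSupport χ → tsupport χ ⊆ Ioo 0 T →
      ∫ z in slab T, χ z.1 * f z.1 z.2 = 0) :
    ∀ᵐ t ∂(volume.restrict (Ioo 0 T)), ∫ y, f t y = 0 := by
  rw [ae_restrict_iff' measurableSet_Ioo]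
  refine isOpen_Ioo.ae_eq_zero_of_integral_contDiff_smul_eq_zero ?_ ?_
  · rw [locallyIntegrableOn_iff isOpen_Ioo.isLocallyClosed]
    intro J hJ hc
    have := hf J hJ hc
    rw [IntegrableOn, Measure.volume_eq_prod, ← Measure.prod_restrict, Measure.restrict_univ] at this
    exact this.integral_prod_left
  · intro χ h1 h2 h3
    have h4 := hf.integrable_mul h1.continuous h2 h3
    have h5 := h χ h1 h2 h3
    rw [volume_restrict_slab] at h4 h5
    rw [integral_prod _ h4] at h5
    simp only [integral_const_mul] at h5
    rw [← setIntegral_eq_integral_of_forall_compl_eq_zero (s := Ioo 0 T)]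
    · exact h5
    · intro t ht
      simp [image_eq_zero_of_notMem_tsupport fun h => ht (h3 h)]

lemma SliceIntegrable.add {T : ℝ} {f g : ℝ → E3 → ℝ} (hf : SliceIntegrable T f)
    (hg : SliceIntegrable T g) : SliceIntegrable T (fun t y => f t y + g t y) :=
  fun J h1 h2 => (hf J h1 h2).add (hg J h1 h2)

lemma sliceIntegrable_of_compact {T : ℝ} {f : ℝ → E3 → ℝ} {K : Set E3}
    (h0 : ∀ t, ∀ y ∉ K, f t y = 0)
    (hf : ∀ J ⊆ Ioo 0 T, IsCompact J → IntegrableOn (Function.uncurry f) (J ×ˢ K) volume) :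
    SliceIntegrable T f := by
  intro J h1 h2
  refine (hf J h1 h2).of_forall_sdiff_eq_zero (h2.measurableSet.prod MeasurableSet.univ) ?_
  rintro ⟨t, y⟩ ⟨⟨h3, -⟩, h4⟩
  exact h0 t y fun h => h4 ⟨h3, h⟩

/-! ### Integrability of the terms of the weak equations -/

section fields

variable {T : ℝ} {u : ℝ → E3 → E3}

/-- Terms linear and quadratic in `u` share the majorant `1 + |u|²`, which is integrable on compact
sets since `u` is locally square integrable. -/
lemma integrableOn_of_norm_le_one_add_sq
    (h2 : LocallyIntegrableOn (fun z : ℝ × E3 => ‖u z.1 z.2‖ ^ 2) (slab T) volume)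
    {J : Set ℝ} (hJ : J ⊆ Ioo 0 T) (hc : IsCompact J) {K : Set E3} (hK : IsCompact K)
    {f : ℝ × E3 → ℝ} (hf : AEStronglyMeasurable f (volume.restrict (slab T))) {C : ℝ}
    (hb : ∀ z, ‖f z‖ ≤ C * (1 + ‖u z.1 z.2‖ ^ 2)) : IntegrableOn f (J ×ˢ K) volume := by
  have hs : J ×ˢ K ⊆ slab T := prod_mono hJ (subset_univ _)
  have hi := h2.integrableOn_compact_subset hs (hc.prod hK)
  have h1 : IntegrableOn (fun _ : ℝ × E3 => (1 : ℝ)) (J ×ˢ K) volume :=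
    integrableOn_const (hc.prod hK).measure_lt_top.ne
  exact Integrable.mono' ((h1.add hi).const_mul C) (hf.mono_measure (Measure.restrict_mono hs le_rfl))
    (Eventually.of_forall hb)

lemma sliceIntegrable_linear
    (hu : AEStronglyMeasurable (Function.uncurry u) (volume.restrict (slab T)))
    (h2 : LocallyIntegrableOn (fun z : ℝ × E3 => ‖u z.1 z.2‖ ^ 2) (slab T) volume)
    {k : E3 → E3 →L[ℝ] ℝ} (hk : Continuous k) (hkc : HasCompactSupport k) :
    SliceIntegrable T (fun t y => k y (u t y)) := by
  obtain ⟨C, hC⟩ := hk.bounded_above_of_compact_support hkc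
  refine sliceIntegrable_of_compact (K := tsupport k) (fun t y hy => ?_) fun J hJ hc => ?_
  · simp [image_eq_zero_of_notMem_tsupport hy]
  · refine integrableOn_of_norm_le_one_add_sq (C := C) h2 hJ hc hkc ?_ fun z => ?_
    · exact isBoundedBilinearMap_apply.continuous.comp_aestronglyMeasurable
        ((hk.comp continuous_snd).aestronglyMeasurable.prodMk hu)
    · refine (ContinuousLinearMap.le_opNorm _ _).trans ?_
      have h0 : 0 ≤ C := (norm_nonneg _).trans (hC 0)
      gcongr
      · exact hC _
      · nlinarith [sq_nonneg (‖u z.1 z.2‖ - 1)]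

lemma sliceIntegrable_quadratic
    (hu : AEStronglyMeasurable (fun z : ℝ × E3 => u z.1 z.2) (volume.restrict (slab T)))
    (h2 : LocallyIntegrableOn (fun z : ℝ × E3 => ‖u z.1 z.2‖ ^ 2) (slab T) volume)
    {k : E3 → E3 →L[ℝ] E3 →L[ℝ] ℝ} (hk : Continuous k) (hkc : HasCompactSupport k) :
    SliceIntegrable T (fun t y => k y (u t y) (u t y)) := by
  obtain ⟨C, hC⟩ : ∃ C, ∀ x, ‖k x‖ ≤ C := by
    exact Continuous.bounded_above_of_compact_support (E := E3 →L[ℝ] E3 →L[ℝ] ℝ) hk hkc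
  refine sliceIntegrable_of_compact (K := tsupport k) (fun t y hy => ?_) fun J hJ hc => ?_
  · simp [image_eq_zero_of_notMem_tsupport hy]
  · refine integrableOn_of_norm_le_one_add_sq (C := C) h2 hJ hc hkc ?_ fun z => ?_
    · have h1 : AEStronglyMeasurable (fun z : ℝ × E3 => k z.2 (u z.1 z.2))
          (volume.restrict (slab T)) :=
        (isBoundedBilinearMap_apply (𝕜 := ℝ) (E := E3) (F := E3 →L[ℝ] ℝ)).continuous.comp_aestronglyMeasurable
          ((hk.comp continuous_snd).aestronglyMeasurable.prodMk hu)
      exact (isBoundedBilinearMap_apply (𝕜 := ℝ) (E := E3) (F := ℝ)).continuous.comp_aestronglyMeasurable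
        (h1.prodMk hu)
    · refine (ContinuousLinearMap.le_opNorm₂ _ _ _).trans ?_
      have h0 : 0 ≤ C := (norm_nonneg (k 0)).trans (hC 0)
      rw [mul_assoc]
      gcongr
      · exact hC _
      · nlinarith [sq_nonneg (‖u z.1 z.2‖ - 1)]

lemma sliceIntegrable_mul {p : ℝ → E3 → ℝ}
    (hp : LocallyIntegrableOn (Function.uncurry p) (slab T) volume)
    {k : E3 → ℝ} (hk : Continuous k) (hkc : HasCompactSupport k) :
    SliceIntegrable T (fun t y => p t y * k y) := by
  obtain ⟨C, hC⟩ := hk.bounded_above_of_compact_support hkc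
  refine sliceIntegrable_of_compact (K := tsupport k) (fun t y hy => ?_) fun J hJ hc => ?_
  · simp [image_eq_zero_of_notMem_tsupport hy]
  · exact Integrable.mul_bdd (c := C)
      (hp.integrableOn_compact_subset (prod_mono hJ (subset_univ _)) (hc.prod hkc))
      (hk.comp continuous_snd).aestronglyMeasurable (Eventually.of_forall fun z => hC z.2)

end fields

/-! ### Gradient fields as test fields -/

/-- The Laplacian of a scalar function, as the trace of the second derivative. -/
noncomputable def lap (ψ : E3 → ℝ) (y : E3) : ℝ :=
  ∑ i : Fin 3, fderiv ℝ (fderiv ℝ ψ) y (EuclideanSpace.single i 1) (EuclideanSpace.single i 1)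

lemma two_le_infty : (2 : WithTop ℕ∞) ≤ ((⊤ : ℕ∞) : WithTop ℕ∞) := WithTop.coe_le_coe.2 (le_top (a := (2 : ℕ∞)))

lemma fderiv_apply_const {F G H : Type*} [NormedAddCommGroup F] [NormedSpace ℝ F]
    [NormedAddCommGroup G] [NormedSpace ℝ G] [NormedAddCommGroup H] [NormedSpace ℝ H]
    {k : F → G →L[ℝ] H} {y : F}
    (hk : DifferentiableAt ℝ k y) (a : G) (v : F) :
    fderiv ℝ (fun z => k z a) y v = fderiv ℝ k y v a := by
  rw [fderiv_clm_apply hk (differentiableAt_const a)]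
  simp

section testFunctions

variable {ψ : E3 → ℝ}

lemma inner_gradient (ψ : E3 → ℝ) (y w : E3) : inner ℝ w (gradient ψ y) = fderiv ℝ ψ y w := by
  rw [real_inner_comm, gradient, InnerProductSpace.toDual_symm_apply]

lemma contDiff_gradient (hψ : ContDiff ℝ ∞ ψ) : ContDiff ℝ ∞ (gradient ψ) :=
  (InnerProductSpace.toDual ℝ E3).symm.toContinuousLinearEquiv.contDiff.comp
    (hψ.fderiv_right (m := ∞) (by simp))

lemma contDiff_fderiv {F : Type*} [NormedAddCommGroup F] [NormedSpace ℝ F] {ψ : E3 → F}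
    (hψ : ContDiff ℝ ∞ ψ) : ContDiff ℝ ∞ (fderiv ℝ ψ) :=
  hψ.fderiv_right (m := ∞) (by simp)

lemma contDiff_lap (hψ : ContDiff ℝ ∞ ψ) : ContDiff ℝ ∞ (lap ψ) := by
  unfold lap
  refine ContDiff.sum fun i _ => ?_
  exact ((contDiff_fderiv (contDiff_fderiv hψ)).clm_apply contDiff_const).clm_apply contDiff_const

lemma hasCompactSupport_lap (hc : HasCompactSupport ψ) : HasCompactSupport (lap ψ) := by
  refine (hc.fderiv ℝ |>.fderiv ℝ).mono' fun y hy => subset_tsupport _ ?_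
  contrapose! hy
  simp only [Function.mem_support, not_not] at hy
  simp [lap, hy]

lemma hasCompactSupport_gradient (hc : HasCompactSupport ψ) : HasCompactSupport (gradient ψ) := by
  refine (hc.fderiv ℝ).mono' fun y hy => subset_tsupport _ ?_
  contrapose! hy
  simp only [Function.mem_support, not_not] at hy
  simp [gradient, hy]

lemma inner_fderiv_gradient (hψ : ContDiff ℝ ∞ ψ) (y v w : E3) :
    inner ℝ w (fderiv ℝ (gradient ψ) y v) = fderiv ℝ (fderiv ℝ ψ) y v w := by
  have h : fderiv ℝ (fun z => innerSL ℝ w (gradient ψ z)) y v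
      = innerSL ℝ w (fderiv ℝ (gradient ψ) y v) := by
    have h1 := ((contDiff_gradient hψ).differentiable (by simp) y).hasFDerivAt
    have h2 : HasFDerivAt (fun z => innerSL ℝ w (gradient ψ z))
        ((innerSL ℝ w).comp (fderiv ℝ (gradient ψ) y)) y := (innerSL ℝ w).hasFDerivAt.comp y h1
    rw [h2.fderiv]
    rfl
  rw [← innerSL_apply_apply ℝ, ← h]
  simp only [innerSL_apply_apply, inner_gradient]
  exact fderiv_apply_const ((contDiff_fderiv hψ).differentiable (by simp) y) w v

/-- Symmetry of third derivatives. It makes the viscous term, tested with `∇ψ`, equal to `u ·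
∇(Δψ)`, which incompressibility kills. -/
lemma sum_third_derivative (hψ : ContDiff ℝ ∞ ψ) (y w : E3) :
    ∑ i : Fin 3, fderiv ℝ (fderiv ℝ (fun z => fderiv ℝ ψ z w)) y (EuclideanSpace.single i 1)
      (EuclideanSpace.single i 1) = fderiv ℝ (lap ψ) y w := by
  have d1 := contDiff_fderiv hψ
  have d2 := contDiff_fderiv d1
  have d3 : Differentiable ℝ (fderiv ℝ (fderiv ℝ ψ)) := d2.differentiable (by simp)
  have key : ∀ v a b : E3, fderiv ℝ (fun z => fderiv ℝ (fderiv ℝ ψ) z a b) y v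
      = fderiv ℝ (fderiv ℝ (fderiv ℝ ψ)) y v a b := by
    intro v a b
    rw [fderiv_apply_const (k := fun z => fderiv ℝ (fderiv ℝ ψ) z a) (by fun_prop) b v,
      fderiv_apply_const (by fun_prop) a v]
  have symm2 : ∀ z a b, fderiv ℝ (fderiv ℝ ψ) z a b = fderiv ℝ (fderiv ℝ ψ) z b a := fun z a b =>
    (hψ.contDiffAt.isSymmSndFDerivAt (by simpa using two_le_infty)).eq a b
  have symm3 : ∀ a b, fderiv ℝ (fderiv ℝ (fderiv ℝ ψ)) y a b
      = fderiv ℝ (fderiv ℝ (fderiv ℝ ψ)) y b a := fun a b =>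
    (d1.contDiffAt.isSymmSndFDerivAt (by simpa using two_le_infty)).eq a b
  have h1 : fderiv ℝ (lap ψ) y w = ∑ i : Fin 3, fderiv ℝ (fderiv ℝ (fderiv ℝ ψ)) y w
      (EuclideanSpace.single i 1) (EuclideanSpace.single i 1) := by
    unfold lap
    rw [fderiv_fun_sum (fun i _ => by fun_prop), sum_apply]
    exact Finset.sum_congr rfl fun i _ => key _ _ _
  rw [h1]
  refine Finset.sum_congr rfl fun i _ => ?_
  set e : E3 := EuclideanSpace.single i 1
  have h2 : fderiv ℝ (fun z => fderiv ℝ ψ z w) = fun z => (fderiv ℝ (fderiv ℝ ψ) z).flip w := by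
    funext z
    ext v
    exact fderiv_apply_const (d1.differentiable (by simp) z) w v
  have h3 : Differentiable ℝ (fderiv ℝ (fun z => fderiv ℝ ψ z w)) := by
    refine (contDiff_fderiv (d1.clm_apply contDiff_const)).differentiable (by simp)
  rw [← fderiv_apply_const (h3 y) e e, h2]
  simp only [ContinuousLinearMap.flip_apply]
  rw [key, symm3 w e, ← key, ← key]
  simp only [symm2 _ e w]

lemma inner_laplacian_gradient (hψ : ContDiff ℝ ∞ ψ) (y w : E3) :
    inner ℝ w (Laplacian.laplacian (gradient ψ) y) = fderiv ℝ (lap ψ) y w := by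
  have h1 := ((contDiff_gradient hψ).contDiffAt (x := y)).of_le (m := 2) two_le_infty
    |>.laplacian_CLM_comp_left (l := innerSL ℝ w)
  have h2 : (innerSL ℝ w) ∘ gradient ψ = fun z => fderiv ℝ ψ z w := by
    funext z
    exact inner_gradient ψ z w
  rw [h2, InnerProductSpace.laplacian_eq_iteratedFDeriv_orthonormalBasis _
    (EuclideanSpace.basisFun (Fin 3) ℝ)] at h1
  simp only [Function.comp_apply, innerSL_apply_apply] at h1
  rw [← h1, ← sum_third_derivative hψ]
  simp [iteratedFDeriv_two_apply]

lemma isTest_smul {T : ℝ} {F : Type*} [NormedAddCommGroup F] [NormedSpace ℝ F] {χ : ℝ → ℝ}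
    (h1 : ContDiff ℝ ∞ χ) (h2 : HasCompactSupport χ) (h3 : tsupport χ ⊆ Ioo 0 T) {f : E3 → F}
    (hf : ContDiff ℝ ∞ f) (hc : HasCompactSupport f) : IsTest T (fun t y => χ t • f y) := by
  have hsub : tsupport (Function.uncurry fun t y => χ t • f y) ⊆ tsupport χ ×ˢ tsupport f := by
    refine closure_minimal ?_ ((isClosed_tsupport _).prod (isClosed_tsupport _))
    rintro ⟨t, y⟩ h
    simp only [Function.mem_support, Function.uncurry_apply_pair] at h
    exact ⟨subset_tsupport _ (left_ne_zero_of_smul h), subset_tsupport _ (right_ne_zero_of_smul h)⟩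
  refine ⟨(h1.comp contDiff_fst).smul (hf.comp contDiff_snd), ?_, ?_⟩
  · exact HasCompactSupport.of_support_subset_isCompact (h2.prod hc)
      ((subset_tsupport _).trans hsub)
  · exact hsub.trans (prod_mono h3 (subset_univ _))

end testFunctions

/-! ### The pressure equation at almost every time -/

section slices

variable {ν T : ℝ} {u : ℝ → E3 → E3} {p : ℝ → E3 → ℝ}

lemma IsNavierStokesSolution.integral_linear (hsol : IsNavierStokesSolution ν T u p)
    {ψ : E3 → ℝ} (hψ : ContDiff ℝ ∞ ψ) (hc : HasCompactSupport ψ)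
    {χ : ℝ → ℝ} (h1 : ContDiff ℝ ∞ χ) (h2 : HasCompactSupport χ) (h3 : tsupport χ ⊆ Ioo 0 T) :
    ∫ z in slab T, χ z.1 * fderiv ℝ ψ z.2 (u z.1 z.2) = 0 := by
  rw [← hsol.divergence_free _ (isTest_smul h1 h2 h3 hψ hc)]
  refine integral_congr_ae (Eventually.of_forall fun z => ?_)
  simp only [inner_gradient, smul_eq_mul]
  rw [fderiv_const_mul (hψ.differentiable (by simp) _)]
  simp

lemma IsNavierStokesSolution.ae_integral_fderiv (hsol : IsNavierStokesSolution ν T u p)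
    {ψ : E3 → ℝ} (hψ : ContDiff ℝ ∞ ψ) (hc : HasCompactSupport ψ) :
    ∀ᵐ t ∂(volume.restrict (Ioo 0 T)), ∫ y, fderiv ℝ ψ y (u t y) = 0 :=
  (sliceIntegrable_linear hsol.measurable_velocity hsol.locally_square_integrable
    (contDiff_fderiv hψ).continuous (hc.fderiv ℝ)).ae_integral_eq_zero
    fun _ h1 h2 h3 => hsol.integral_linear hψ hc h1 h2 h3

/-- The test field is `χ(t)∇ψ(y)`. Its time derivative `χ'∇ψ` and its Laplacian `χ∇Δψ` are again
gradients, hence orthogonal to `u`; only the convective and pressure terms survive. -/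
lemma IsNavierStokesSolution.ae_integral_hessian (hsol : IsNavierStokesSolution ν T u p)
    {ψ : E3 → ℝ} (hψ : ContDiff ℝ ∞ ψ) (hc : HasCompactSupport ψ) :
    ∀ᵐ t ∂(volume.restrict (Ioo 0 T)),
      ∫ y, (fderiv ℝ (fderiv ℝ ψ) y (u t y) (u t y) + p t y * lap ψ y) = 0 := by
  have m1 := hsol.measurable_velocity
  have m2 := hsol.locally_square_integrable
  have s1 := sliceIntegrable_linear m1 m2 (contDiff_fderiv hψ).continuous (hc.fderiv ℝ)
  have s2 := sliceIntegrable_linear m1 m2 (contDiff_fderiv (contDiff_lap hψ)).continuous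
    ((hasCompactSupport_lap hc).fderiv ℝ)
  have s3 := (sliceIntegrable_quadratic m1 m2 (contDiff_fderiv (contDiff_fderiv hψ)).continuous
    ((hc.fderiv ℝ).fderiv ℝ)).add (sliceIntegrable_mul hsol.pressure_locally_integrable
    (contDiff_lap hψ).continuous (hasCompactSupport_lap hc))
  refine s3.ae_integral_eq_zero fun χ h1 h2 h3 => ?_
  have hm := hsol.momentum _ (isTest_smul h1 h2 h3 (contDiff_gradient hψ)
    (hasCompactSupport_gradient hc))
  have d1 : ContDiff ℝ ∞ (deriv χ) := ((contDiff_infty_iff_deriv).1 h1).2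
  have d2 : HasCompactSupport (deriv χ) := h2.deriv
  have d3 : tsupport (deriv χ) ⊆ Ioo 0 T := (tsupport_deriv_subset).trans h3
  have i1 := s1.integrable_mul d1.continuous d2 d3
  have i2 := (s2.integrable_mul h1.continuous h2 h3).const_mul ν
  have i3 := s3.integrable_mul h1.continuous h2 h3
  have e1 := hsol.integral_linear hψ hc d1 d2 d3
  have e2 := hsol.integral_linear (contDiff_lap hψ) (hasCompactSupport_lap hc) h1 h2 h3
  -- The two vanishing integrals are added back, so that the total integrand matches that of
  -- `momentum` pointwise.
  have hsum := integral_add (i1.add i2) i3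
  rw [integral_add' i1 i2, e1, integral_const_mul, e2] at hsum
  simp only [mul_zero, zero_add] at hsum
  rw [← hsum, ← hm]
  refine integral_congr_ae (Eventually.of_forall fun z => ?_)
  have gd := (contDiff_gradient hψ).differentiable (by simp) z.2
  have t1 : inner ℝ (u z.1 z.2) (deriv (fun s => χ s • gradient ψ z.2) z.1)
      = deriv χ z.1 * fderiv ℝ ψ z.2 (u z.1 z.2) := by
    rw [deriv_smul_const (h1.differentiable (by simp) z.1), inner_smul_right, inner_gradient]
  have t2 : ∀ v w : E3, inner ℝ w (fderiv ℝ (fun y => χ z.1 • gradient ψ y) z.2 v)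
      = χ z.1 * fderiv ℝ (fderiv ℝ ψ) z.2 v w := by
    intro v w
    rw [fderiv_fun_const_smul gd, smul_apply, inner_smul_right,
      inner_fderiv_gradient hψ]
  have t3 : inner ℝ (u z.1 z.2) (Laplacian.laplacian (fun y => χ z.1 • gradient ψ y) z.2)
      = χ z.1 * fderiv ℝ (lap ψ) z.2 (u z.1 z.2) := by
    have := InnerProductSpace.laplacian_smul (χ z.1) (f := gradient ψ) (x := z.2)
      (((contDiff_gradient hψ).contDiffAt).of_le two_le_infty)
    change Laplacian.laplacian (fun y => χ z.1 • gradient ψ y) z.2 = _ at this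
    rw [this, inner_smul_right, inner_laplacian_gradient hψ]
  have t4 : divergence (fun y => χ z.1 • gradient ψ y) z.2 = χ z.1 * lap ψ z.2 := by
    simp only [divergence, lap, Finset.mul_sum]
    refine Finset.sum_congr rfl fun i _ => ?_
    rw [← t2, EuclideanSpace.inner_single_left]
    simp
  simp only [Pi.add_apply]
  rw [t1, t2, t3, t4]
  ring

end slices

/-! ### Second derivatives under scaling, and the construction of the kernel -/

section scaling

variable {F : Type*} [NormedAddCommGroup F] [NormedSpace ℝ F]

lemma fderiv_comp_smul_sub {f : E3 → F} (hf : Differentiable ℝ f) (c : ℝ) (x y : E3) :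
    fderiv ℝ (fun y => f (c • (y - x))) y = c • fderiv ℝ f (c • (y - x)) := by
  have h1 : HasFDerivAt (fun y : E3 => c • (y - x)) (c • ContinuousLinearMap.id ℝ E3) y :=
    ((hasFDerivAt_id y).sub_const x).const_smul c
  have h2 : HasFDerivAt (fun y => f (c • (y - x)))
      ((fderiv ℝ f (c • (y - x))).comp (c • ContinuousLinearMap.id ℝ E3)) y :=
    (hf _).hasFDerivAt.comp y h1
  rw [h2.fderiv]
  ext v
  simp

lemma fderiv_fun_smul_of_differentiable {f : E3 → F} (hf : Differentiable ℝ f) (c : ℝ) (y : E3) :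
    fderiv ℝ (fun y => c • f y) y = c • fderiv ℝ f y := fderiv_fun_const_smul (hf y) c

lemma hessian_comp_smul_sub {f : E3 → ℝ} (hf : ContDiff ℝ ∞ f) (c : ℝ) (x y : E3) :
    fderiv ℝ (fderiv ℝ (fun y => f (c • (y - x)))) y
      = c ^ 2 • fderiv ℝ (fderiv ℝ f) (c • (y - x)) := by
  have d := (contDiff_fderiv hf).differentiable (by simp)
  have h1 : fderiv ℝ (fun y => f (c • (y - x))) = fun y => c • fderiv ℝ f (c • (y - x)) :=
    funext fun y => fderiv_comp_smul_sub (hf.differentiable (by simp)) c x y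
  have d' : Differentiable ℝ (fun y => fderiv ℝ f (c • (y - x))) := by fun_prop
  have h2 := fderiv_fun_smul_of_differentiable (F := E3 →L[ℝ] ℝ) d' c y
  have h3 := fderiv_comp_smul_sub (F := E3 →L[ℝ] ℝ) d c x y
  rw [h1, sq, mul_smul]
  exact h2.trans (congrArg (c • ·) h3)

lemma hessian_const_mul {f : E3 → ℝ} (hf : ContDiff ℝ ∞ f) (a : ℝ) (y : E3) :
    fderiv ℝ (fderiv ℝ (fun y => a * f y)) y = a • fderiv ℝ (fderiv ℝ f) y := by
  have d := (contDiff_fderiv hf).differentiable (by simp)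
  have h1 : fderiv ℝ (fun y => a * f y) = fun y => a • fderiv ℝ f y :=
    funext fun y => fderiv_const_mul (hf.differentiable (by simp) y) a
  rw [h1]
  exact fderiv_fun_smul_of_differentiable (F := E3 →L[ℝ] ℝ) d a y

lemma hessian_sub {f g : E3 → ℝ} (hf : ContDiff ℝ ∞ f) (hg : ContDiff ℝ ∞ g) (y : E3) :
    fderiv ℝ (fderiv ℝ (fun y => f y - g y)) y
      = fderiv ℝ (fderiv ℝ f) y - fderiv ℝ (fderiv ℝ g) y := by
  have d := (contDiff_fderiv hf).differentiable (by simp)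
  have d' := (contDiff_fderiv hg).differentiable (by simp)
  have h1 : fderiv ℝ (fun y => f y - g y) = fun y => fderiv ℝ f y - fderiv ℝ g y :=
    funext fun y => fderiv_fun_sub (hf.differentiable (by simp) y) (hg.differentiable (by simp) y)
  rw [h1, fderiv_fun_sub (by fun_prop) (by fun_prop)]

end scaling

/-- With this `g`, the function `g(|y|²)` is the Newtonian potential `1/|y|` smoothed near the
origin. -/
lemma exists_smooth_rpow : ∃ g : ℝ → ℝ, ContDiff ℝ ∞ g ∧
    ∀ s, 1 / 2 < s → g s = s ^ (-1 / 2 : ℝ) := by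
  -- The cutoff is `0` for `s ≤ 1/4` and `1` for `s ≥ 1/2`, so the singularity of the power at `0`
  -- is never seen.
  refine ⟨fun s => Real.smoothTransition (4 * s - 1) * s ^ (-1 / 2 : ℝ), ?_, fun s hs => ?_⟩
  · rw [contDiff_iff_contDiffAt]
    intro s
    rcases lt_or_ge s (1 / 4) with h | h
    · refine (contDiffAt_const (c := (0 : ℝ))).congr_of_eventuallyEq ?_
      filter_upwards [Iio_mem_nhds h] with t ht
      rw [Real.smoothTransition.zero_of_nonpos, zero_mul]
      linarith [mem_Iio.1 ht]
    · refine ContDiffAt.mul ?_ (Real.contDiffAt_rpow_const_of_ne (by linarith))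
      exact (Real.smoothTransition.contDiff.comp
        ((contDiff_const.mul contDiff_id).sub contDiff_const)).contDiffAt
  · simp only
    rw [Real.smoothTransition.one_of_one_le (by linarith), one_mul]

lemma deriv_eq_of_eq_rpow {f : ℝ → ℝ} {a b : ℝ}
    (h : ∀ s, 1 / 2 < s → f s = a * s ^ b) (s : ℝ) (hs : 1 / 2 < s) :
    deriv f s = (a * b) * s ^ (b - 1) := by
  have h1 : f =ᶠ[𝓝 s] fun s => a * s ^ b := by
    filter_upwards [Ioi_mem_nhds hs] with t ht using h t ht
  rw [h1.deriv_eq, deriv_const_mul _ (Real.differentiableAt_rpow_const_of_ne _ (by linarith)),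
    Real.deriv_rpow_const, mul_assoc]

section radial

variable {g : ℝ → ℝ}

lemma fderiv_comp_norm_sq (hg : Differentiable ℝ g) (x : E3) :
    fderiv ℝ (fun y : E3 => g (‖y‖ ^ 2)) x = (2 * deriv g (‖x‖ ^ 2)) • innerSL ℝ x := by
  have h1 := (hasStrictFDerivAt_norm_sq x).hasFDerivAt
  have h2 := (hg (‖x‖ ^ 2)).hasDerivAt.comp_hasFDerivAt x h1
  have h3 : fderiv ℝ (fun y : E3 => g (‖y‖ ^ 2)) x = _ := h2.fderiv
  rw [h3]
  ext v
  simp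
  ring

lemma lap_comp_norm_sq (hg : ContDiff ℝ ∞ g) (x : E3) :
    lap (fun y : E3 => g (‖y‖ ^ 2)) x
      = 6 * deriv g (‖x‖ ^ 2) + 4 * ‖x‖ ^ 2 * deriv (deriv g) (‖x‖ ^ 2) := by
  have hg' : ContDiff ℝ ∞ (deriv g) := ((contDiff_infty_iff_deriv).1 hg).2
  have h1 : fderiv ℝ (fun y : E3 => g (‖y‖ ^ 2)) = fun x => (2 * deriv g (‖x‖ ^ 2)) • innerSL ℝ x :=
    funext fun x => fderiv_comp_norm_sq (hg.differentiable (by simp)) x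
  have h2 : ∀ v w : E3, fderiv ℝ (fun x : E3 => (2 * deriv g (‖x‖ ^ 2)) • innerSL ℝ x) x v w
      = 4 * deriv (deriv g) (‖x‖ ^ 2) * inner ℝ x v * inner ℝ x w
        + 2 * deriv g (‖x‖ ^ 2) * inner ℝ v w := by
    intro v w
    have d1 : DifferentiableAt ℝ (fun y : E3 => deriv g (‖y‖ ^ 2)) x :=
      (hg'.comp (contDiff_norm_sq ℝ)).differentiable (by simp) x
    have d2 : DifferentiableAt ℝ (fun x : E3 => innerSL ℝ x) x := (innerSL ℝ).differentiableAt
    have d3 : fderiv ℝ (fun x : E3 => innerSL ℝ x) x = innerSL ℝ := (innerSL ℝ).fderiv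
    rw [fderiv_fun_smul (d1.const_mul 2) d2, d3, fderiv_const_mul d1,
      fderiv_comp_norm_sq (hg'.differentiable (by simp))]
    have h3 : innerSL ℝ v w = inner ℝ v w := rfl
    simp [h3]
    ring
  rw [lap, h1]
  simp only [h2]
  have h3 : ∑ i : Fin 3, inner ℝ x (EuclideanSpace.single i (1 : ℝ))
      * inner ℝ x (EuclideanSpace.single i (1 : ℝ)) = ‖x‖ ^ 2 := by
    rw [EuclideanSpace.norm_sq_eq]
    refine Finset.sum_congr rfl fun i _ => ?_
    simp [EuclideanSpace.inner_single_right, sq]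
  simp only [mul_assoc, Finset.sum_add_distrib, ← Finset.mul_sum, h3]
  simp
  ring

/-- Divergence theorem in radial form: `r²` times the radial Laplacian is the derivative of
`2r³g'(r²)`, so the integral is determined by the flux of `1/|y|` through the unit sphere. -/
lemma integral_radial_laplacian (hg : ContDiff ℝ ∞ g)
    (h : ∀ s, 1 / 2 < s → deriv g s = -1 / 2 * s ^ (-3 / 2 : ℝ))
    (h0 : ∀ r, 1 ≤ r → 6 * deriv g (r ^ 2) + 4 * r ^ 2 * deriv (deriv g) (r ^ 2) = 0) :
    ∫ z : E3, (6 * deriv g (‖z‖ ^ 2) + 4 * ‖z‖ ^ 2 * deriv (deriv g) (‖z‖ ^ 2)) ≠ 0 := by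
  have hg' : ContDiff ℝ ∞ (deriv g) := ((contDiff_infty_iff_deriv).1 hg).2
  have hg'' : ContDiff ℝ ∞ (deriv (deriv g)) := ((contDiff_infty_iff_deriv).1 hg').2
  have c1 := hg'.continuous
  have c2 := hg''.continuous
  rw [integral_fun_norm_addHaar volume
    (fun r : ℝ => 6 * deriv g (r ^ 2) + 4 * r ^ 2 * deriv (deriv g) (r ^ 2))]
  have key : ∫ y in Ioi (0 : ℝ), y ^ (Module.finrank ℝ E3 - 1) •
      (6 * deriv g (y ^ 2) + 4 * y ^ 2 * deriv (deriv g) (y ^ 2)) = -1 := by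
    have hd : ∀ y : ℝ, HasDerivAt (fun y => 2 * y ^ 3 * deriv g (y ^ 2))
        (y ^ 2 * (6 * deriv g (y ^ 2) + 4 * y ^ 2 * deriv (deriv g) (y ^ 2))) y := by
      intro y
      have e1 : HasDerivAt (fun y : ℝ => deriv g (y ^ 2)) (deriv (deriv g) (y ^ 2) * (2 * y)) y := by
        have := (hg'.differentiable (by simp) (y ^ 2)).hasDerivAt.comp y (hasDerivAt_pow 2 y)
        exact this.congr_deriv (by simp)
      have e2 : HasDerivAt (fun y : ℝ => 2 * y ^ 3) (2 * (3 * y ^ 2)) y := by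
        simpa using (hasDerivAt_pow 3 y).const_mul (2 : ℝ)
      convert! e2.mul e1 using 1
      ring
    rw [setIntegral_eq_of_subset_of_forall_sdiff_eq_zero measurableSet_Ioi
      (Ioc_subset_Ioi_self : Ioc (0 : ℝ) 1 ⊆ Ioi 0), ← intervalIntegral.integral_of_le zero_le_one]
    · have := intervalIntegral.integral_eq_sub_of_hasDerivAt (a := 0) (b := 1) (fun y _ => hd y)
        (Continuous.intervalIntegrable (by fun_prop) _ _)
      simp only [finrank_euclideanSpace, Fintype.card_fin, smul_eq_mul]
      rw [show 3 - 1 = 2 from rfl, this]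
      rw [show (1 : ℝ) ^ 2 = 1 by norm_num, h 1 (by norm_num)]
      norm_num
    · intro y hy
      have h1 : 1 ≤ y := by
        by_contra hcon
        exact hy.2 ⟨hy.1, (not_le.1 hcon).le⟩
      simp [h0 y h1]
  rw [key]
  have hv : volume.real (Metric.ball (0 : E3) 1) ≠ 0 :=
    (ENNReal.toReal_pos (Metric.measure_ball_pos _ _ one_pos).ne' measure_ball_lt_top.ne).ne'
  simpa using hv

end radial

/-- A compactly supported function whose Laplacian is the difference of a radial mass distribution
and its dilation by a factor `2`. -/
theorem exists_kernel : ∃ (Ψ : E3 → ℝ) (h : ℝ → ℝ), ContDiff ℝ ∞ Ψ ∧ (∀ z, 2 ≤ ‖z‖ → Ψ z = 0) ∧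
    ContDiff ℝ ∞ h ∧ (∀ r, 1 ≤ r → h r = 0) ∧
    (∀ z, lap Ψ z = h ‖z‖ - h (‖z‖ / 2) / 8) ∧ ∫ z : E3, h ‖z‖ ≠ 0 := by
  obtain ⟨g, hg, hgs⟩ := exists_smooth_rpow
  have hg' : ContDiff ℝ ∞ (deriv g) := ((contDiff_infty_iff_deriv).1 hg).2
  have hg'' : ContDiff ℝ ∞ (deriv (deriv g)) := ((contDiff_infty_iff_deriv).1 hg').2
  have e1 : ∀ s, 1 / 2 < s → deriv g s = -1 / 2 * s ^ (-3 / 2 : ℝ) := by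
    intro s hs
    rw [deriv_eq_of_eq_rpow (a := 1) (b := -1 / 2) (by simpa using hgs) s hs]
    norm_num
  have e2 : ∀ s, 1 / 2 < s → deriv (deriv g) s = 3 / 4 * s ^ (-5 / 2 : ℝ) := by
    intro s hs
    rw [deriv_eq_of_eq_rpow e1 s hs]
    norm_num
  have e3 : ∀ r : ℝ, 1 ≤ r → 6 * deriv g (r ^ 2) + 4 * r ^ 2 * deriv (deriv g) (r ^ 2) = 0 := by
    intro r hr
    have h1 : 1 / 2 < r ^ 2 := by nlinarith
    rw [e1 _ h1, e2 _ h1]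
    have h2 : (r ^ 2) ^ (-3 / 2 : ℝ) = r ^ 2 * (r ^ 2) ^ (-5 / 2 : ℝ) := by
      rw [← Real.rpow_one_add' (by positivity) (by norm_num)]
      norm_num
    rw [h2]
    ring
  set N : E3 → ℝ := fun y => g (‖y‖ ^ 2) with hN
  have hNs : ContDiff ℝ ∞ N := hg.comp (contDiff_norm_sq ℝ)
  have hN2 : ContDiff ℝ ∞ fun y : E3 => N ((1 / 2 : ℝ) • (y - 0)) :=
    hNs.comp ((contDiff_id.sub contDiff_const).const_smul _)
  -- For `|y| ≥ 2` both terms equal `1/|y|` and cancel, which gives the compact support. The weight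
  -- `1/8` of the dilated mass is `1/2` times the factor `(1/2)²` from two derivatives. The dilation
  -- is written with `y - 0` to match `hessian_comp_smul_sub`.
  refine ⟨fun y => N y - 1 / 2 * N ((1 / 2 : ℝ) • (y - 0)),
    fun r => 6 * deriv g (r ^ 2) + 4 * r ^ 2 * deriv (deriv g) (r ^ 2),
    hNs.sub (contDiff_const.mul hN2), fun z hz => ?_, ?_, e3, fun z => ?_, ?_⟩
  · have h1 : (1 : ℝ) / 2 < ‖z‖ ^ 2 := by nlinarith
    have h2 : (1 : ℝ) / 2 < (1 / 2 * ‖z‖) ^ 2 := by nlinarith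
    have hz0 : 0 < ‖z‖ := by linarith
    simp only [hN, sub_zero, norm_smul]
    rw [show ‖(1 / 2 : ℝ)‖ = 1 / 2 by norm_num, hgs _ h1, hgs _ h2, ← Real.rpow_natCast,
      ← Real.rpow_natCast, ← Real.rpow_mul hz0.le, ← Real.rpow_mul (by positivity)]
    norm_num [Real.rpow_neg_one]
    field_simp
    ring
  · exact (contDiff_const.mul (hg'.comp (contDiff_id.pow 2))).add
      ((contDiff_const.mul (contDiff_id.pow 2)).mul (hg''.comp (contDiff_id.pow 2)))
  · have h1 : ∀ y, lap N y = 6 * deriv g (‖y‖ ^ 2) + 4 * ‖y‖ ^ 2 * deriv (deriv g) (‖y‖ ^ 2) :=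
      lap_comp_norm_sq hg
    have h2 : lap (fun y => N y - 1 / 2 * N ((1 / 2 : ℝ) • (y - 0))) z
        = lap N z - 1 / 8 * lap N ((1 / 2 : ℝ) • z) := by
      simp only [lap]
      rw [hessian_sub hNs (contDiff_const.mul hN2), hessian_const_mul hN2,
        hessian_comp_smul_sub hNs, Finset.mul_sum, ← Finset.sum_sub_distrib]
      refine Finset.sum_congr rfl fun i _ => ?_
      simp
      ring
    rw [h2, h1, h1, norm_smul, show ‖(1 / 2 : ℝ)‖ = 1 / 2 by norm_num,
      show 1 / 2 * ‖z‖ = ‖z‖ / 2 by ring]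
    ring
  · exact integral_radial_laplacian hg e1 e3

/-! ### Radial means: large scales and small scales -/

section radialAverages

variable {h : ℝ → ℝ} {p : E3 → ℝ}

lemma setIntegral_deriv_indicator (hh : ContDiff ℝ ∞ h) (h1 : ∀ r, 1 ≤ r → h r = 0) {ρ : ℝ}
    (hρ : 0 ≤ ρ) :
    ∫ s in Ioc (0 : ℝ) 1, (Ioi ρ).indicator (fun s => -deriv h s) s = h ρ := by
  rw [setIntegral_indicator measurableSet_Ioi]
  have hset : Ioc (0 : ℝ) 1 ∩ Ioi ρ = Ioc ρ 1 := by
    ext s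
    simp only [mem_inter_iff, mem_Ioc, mem_Ioi]
    constructor
    · rintro ⟨⟨-, b⟩, c⟩
      exact ⟨c, b⟩
    · rintro ⟨a, b⟩
      exact ⟨⟨hρ.trans_lt a, b⟩, a⟩
  rw [hset, integral_neg]
  rcases lt_or_ge ρ 1 with h2 | h2
  · rw [← intervalIntegral.integral_of_le h2.le, intervalIntegral.integral_deriv_eq_sub'
      h rfl (fun x _ => hh.differentiable (by simp) x)
      ((hh.continuous_deriv (by simp)).continuousOn), h1 1 le_rfl]
    ring
  · rw [Ioc_eq_empty (by simpa using h2), h1 ρ h2]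
    simp

/-- Layer-cake formula: since `h(ρ) = ∫_ρ^1 (-h')`, a radial weight is a superposition of indicators
of balls. This carries information on ball averages, where the pressure is normalized, over to
radial means. -/
lemma integral_radial_mul (hh : ContDiff ℝ ∞ h) (h1 : ∀ r, 1 ≤ r → h r = 0)
    (hp : LocallyIntegrable p) (x : E3) {r : ℝ} (hr : 0 < r) :
    ∫ y, h (‖y - x‖ / r) * p y
      = ∫ s in Ioc (0 : ℝ) 1, -deriv h s * ∫ y in Metric.ball x (r * s), p y := by
  obtain ⟨C, hC⟩ := isCompact_Icc (a := (0 : ℝ)) (b := 1) |>.exists_bound_of_continuousOn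
    (hh.continuous_deriv (by simp)).continuousOn
  set A : Set (ℝ × E3) := {z | dist z.2 x < r * z.1}
  have hA : MeasurableSet A := (isOpen_lt (by fun_prop) (by fun_prop)).measurableSet
  set G : ℝ × E3 → ℝ := A.indicator fun z => -deriv h z.1 * p z.2
  have hG1 : AEStronglyMeasurable G ((volume.restrict (Ioc (0 : ℝ) 1)).prod volume) := by
    refine AEStronglyMeasurable.indicator (AEStronglyMeasurable.mul ?_ ?_) hA
    · exact ((hh.continuous_deriv (by simp)).neg.comp continuous_fst).aestronglyMeasurable
    · exact hp.aestronglyMeasurable.comp_snd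
  have hpi : Integrable ((Metric.ball x r).indicator p) :=
    (integrable_indicator_iff measurableSet_ball).2
      ((hp.integrableOn_isCompact (isCompact_closedBall x r)).mono_set Metric.ball_subset_closedBall)
  have hdom : Integrable (fun z : ℝ × E3 => C * ‖(Metric.ball x r).indicator p z.2‖)
      ((volume.restrict (Ioc (0 : ℝ) 1)).prod volume) :=
    (hpi.norm.comp_snd _).const_mul C
  have hG2 : Integrable G ((volume.restrict (Ioc (0 : ℝ) 1)).prod volume) := by
    refine hdom.mono' hG1 ?_
    have hae : ∀ᵐ z : ℝ × E3 ∂((volume.restrict (Ioc (0 : ℝ) 1)).prod volume),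
        z.1 ∈ Ioc (0 : ℝ) 1 :=
      Measure.quasiMeasurePreserving_fst.ae (ae_restrict_mem measurableSet_Ioc)
    filter_upwards [hae] with z hz
    have hC0 : 0 ≤ C := (norm_nonneg _).trans (hC z.1 ⟨hz.1.le, hz.2⟩)
    by_cases hzA : z ∈ A
    · have hb : z.2 ∈ Metric.ball x r := by
        have : dist z.2 x < r * z.1 := hzA
        rw [Metric.mem_ball]
        nlinarith [hz.2]
      rw [indicator_of_mem hb, show G z = -deriv h z.1 * p z.2 from indicator_of_mem hzA _, norm_mul,
        norm_neg]
      gcongr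
      exact hC z.1 ⟨hz.1.le, hz.2⟩
    · rw [show G z = 0 from indicator_of_notMem hzA _, norm_zero]
      positivity
  have hswap := integral_integral_swap (f := fun s y => G (s, y)) hG2
  have e1 : ∀ s, ∫ y, G (s, y) = -deriv h s * ∫ y in Metric.ball x (r * s), p y := by
    intro s
    rw [← integral_indicator measurableSet_ball, ← integral_const_mul]
    refine integral_congr_ae (Eventually.of_forall fun y => ?_)
    by_cases hy : y ∈ Metric.ball x (r * s)
    · have : (s, y) ∈ A := hy
      simp only
      rw [indicator_of_mem hy, show G (s, y) = -deriv h s * p y from indicator_of_mem this _]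
    · have : (s, y) ∉ A := hy
      simp only
      rw [indicator_of_notMem hy, show G (s, y) = 0 from indicator_of_notMem this _, mul_zero]
  have e2 : ∀ y, ∫ s in Ioc (0 : ℝ) 1, G (s, y) = h (‖y - x‖ / r) * p y := by
    intro y
    rw [← setIntegral_deriv_indicator hh h1 (ρ := ‖y - x‖ / r) (by positivity),
      ← integral_mul_const]
    refine integral_congr_ae (Eventually.of_forall fun s => ?_)
    have hiff : (s, y) ∈ A ↔ s ∈ Ioi (‖y - x‖ / r) := by
      change dist y x < r * s ↔ ‖y - x‖ / r < s
      rw [dist_eq_norm, div_lt_iff₀ hr, mul_comm]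
    by_cases hy : (s, y) ∈ A
    · simp only
      rw [indicator_of_mem (hiff.1 hy), show G (s, y) = -deriv h s * p y from indicator_of_mem hy _]
    · simp only
      rw [indicator_of_notMem fun h => hy (hiff.2 h), show G (s, y) = 0 from indicator_of_notMem hy _,
        zero_mul]
  simp only [e1, e2] at hswap
  exact hswap.symm

lemma exists_radial_bound (hh : ContDiff ℝ ∞ h) (h1 : ∀ r, 1 ≤ r → h r = 0) :
    ∃ C : ℝ, 0 ≤ C ∧ ∀ p : E3 → ℝ, LocallyIntegrable p → ∀ (x : E3) (r B : ℝ), 0 < r →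
      (∀ s, 0 < s → s ≤ r → |∫ y in Metric.ball x s, p y| ≤ B) →
      |∫ y, h (‖y - x‖ / r) * p y| ≤ C * B := by
  obtain ⟨C, hC⟩ := isCompact_Icc (a := (0 : ℝ)) (b := 1) |>.exists_bound_of_continuousOn
    (hh.continuous_deriv (by simp)).continuousOn
  have hC0 : 0 ≤ C := (norm_nonneg _).trans (hC 0 (by simp))
  refine ⟨C, hC0, fun p hp x r B hr hB => ?_⟩
  rw [integral_radial_mul hh h1 hp x hr, ← Real.norm_eq_abs]
  have := norm_setIntegral_le_of_norm_le_const (μ := volume) (s := Ioc (0 : ℝ) 1) (C := C * B)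
    (f := fun s => -deriv h s * ∫ y in Metric.ball x (r * s), p y) (by simp) fun s hs => by
      rw [norm_mul, norm_neg]
      have hb := hB (r * s) (mul_pos hr hs.1) (by nlinarith [hs.2])
      gcongr
      · exact hC s ⟨hs.1.le, hs.2⟩
      · exact hb
  simpa using this

lemma volume_real_ball (x : E3) {r : ℝ} (hr : 0 ≤ r) :
    volume.real (Metric.ball x r) = r ^ 3 * volume.real (Metric.ball (0 : E3) 1) := by
  rw [Measure.real, Measure.addHaar_ball _ x hr, ENNReal.toReal_mul, ENNReal.toReal_ofReal (by positivity)]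
  simp [Measure.real]

/-- In the layer-cake formula, balls of radius beyond some `S'` have small averages, while smaller
balls contribute at most the fixed mass `K`, which the factor `r⁻³` annihilates. -/
lemma tendsto_radial_atTop (hh : ContDiff ℝ ∞ h) (h1 : ∀ r, 1 ≤ r → h r = 0)
    (hp : LocallyIntegrable p) (x : E3)
    (hlim : Tendsto (fun R : ℝ => ⨍ y in Metric.ball x R, p y) atTop (𝓝 0)) :
    Tendsto (fun r : ℝ => (r ^ 3)⁻¹ * ∫ y, h (‖y - x‖ / r) * p y) atTop (𝓝 0) := by
  obtain ⟨C, hC0, hC⟩ := exists_radial_bound hh h1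
  set v := volume.real (Metric.ball (0 : E3) 1)
  have hv : 0 < v := ENNReal.toReal_pos (Metric.measure_ball_pos _ _ one_pos).ne' measure_ball_lt_top.ne
  rw [Metric.tendsto_atTop]
  intro ε hε
  -- Chosen so that `C * δ * v ≤ ε / 2`; the summand `1` covers `C = 0`.
  set δ := ε / (2 * (C + 1) * v)
  have hδ : 0 < δ := by positivity
  obtain ⟨S, hS⟩ := (Metric.tendsto_atTop.1 hlim) δ hδ
  set S' := max S 1
  set K := ∫ y in Metric.ball x S', |p y|
  have hball : ∀ s, IntegrableOn p (Metric.ball x s) := fun s =>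
    (hp.integrableOn_isCompact (isCompact_closedBall x s)).mono_set Metric.ball_subset_closedBall
  have hK0 : 0 ≤ K := integral_nonneg fun _ => abs_nonneg _
  have hm : ∀ r, 0 < r → ∀ s, 0 < s → s ≤ r →
      |∫ y in Metric.ball x s, p y| ≤ δ * v * r ^ 3 + K := by
    intro r hr s hs hsr
    rcases le_total S' s with h2 | h2
    · have h3 := hS s ((le_max_left _ _).trans h2)
      rw [setAverage_eq, volume_real_ball x hs.le, smul_eq_mul, dist_zero_right, Real.norm_eq_abs,
        abs_mul, abs_of_pos (by positivity), inv_mul_lt_iff₀ (by positivity)] at h3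
      have : s ^ 3 * v * δ ≤ δ * v * r ^ 3 := by
        rw [show δ * v * r ^ 3 = r ^ 3 * v * δ by ring]
        gcongr
      linarith
    · have h3 : |∫ y in Metric.ball x s, p y| ≤ K :=
        (norm_integral_le_integral_norm _).trans
          (setIntegral_mono_set (hball S').norm (Eventually.of_forall fun _ => norm_nonneg _)
            (Metric.ball_subset_ball h2).eventuallyLE)
      have : 0 ≤ δ * v * r ^ 3 := by positivity
      linarith
  have hKlim : Tendsto (fun r : ℝ => C * K * (r ^ 3)⁻¹) atTop (𝓝 0) := by
    have := (tendsto_inv_atTop_zero.comp (tendsto_pow_atTop (α := ℝ) three_ne_zero)).const_mul (C * K)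
    simpa using this
  obtain ⟨R, hR⟩ := (Metric.tendsto_atTop.1 hKlim) (ε / 2) (by positivity)
  refine ⟨max R 1, fun r hr => ?_⟩
  have hr0 : 0 < r := lt_of_lt_of_le one_pos ((le_max_right _ _).trans hr)
  have h4 := hC p hp x r _ hr0 (hm r hr0)
  have h5 := hR r ((le_max_left _ _).trans hr)
  rw [dist_zero_right, Real.norm_eq_abs, abs_of_nonneg (by positivity)] at h5
  rw [dist_zero_right, norm_mul, Real.norm_eq_abs, Real.norm_eq_abs, abs_of_pos (by positivity)]
  have h6 : C * δ * v ≤ ε / 2 := by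
    have : δ * (2 * (C + 1) * v) = ε := div_mul_cancel₀ _ (by positivity)
    nlinarith [mul_pos hδ hv]
  calc (r ^ 3)⁻¹ * |∫ y, h (‖y - x‖ / r) * p y| ≤ (r ^ 3)⁻¹ * (C * (δ * v * r ^ 3 + K)) := by gcongr
    _ = C * δ * v + C * K * (r ^ 3)⁻¹ := by field_simp
    _ < ε := by linarith

/-- Lebesgue differentiation with the weights `c⁻¹ r⁻³ h(|y-x|/r)`: they have integral one, live in
the ball of radius `r` and are bounded by a multiple of the inverse of its volume. No sign of `h` is
needed. -/
lemma ae_tendsto_radial (hh : ContDiff ℝ ∞ h) (h1 : ∀ r, 1 ≤ r → h r = 0)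
    (hp : LocallyIntegrable p) {r : ℕ → ℝ} (hr : ∀ n, 0 < r n) (hr0 : Tendsto r atTop (𝓝 0))
    (hc : ∫ z : E3, h ‖z‖ ≠ 0) :
    ∀ᵐ x, Tendsto (fun n => (r n ^ 3)⁻¹ * ∫ y, h (‖y - x‖ / r n) * p y) atTop
      (𝓝 ((∫ z : E3, h ‖z‖) * p x)) := by
  obtain ⟨C, hC⟩ := isCompact_Icc (a := (0 : ℝ)) (b := 1) |>.exists_bound_of_continuousOn
    hh.continuous.continuousOn
  set c := ∫ z : E3, h ‖z‖
  have hb : ∀ ρ, 0 ≤ ρ → |h ρ| ≤ C := by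
    intro ρ hρ
    rcases le_total ρ 1 with h2 | h2
    · exact hC ρ ⟨hρ, h2⟩
    · rw [h1 ρ h2, abs_zero]
      exact (norm_nonneg _).trans (hC 0 (by simp))
  have hC0 : 0 ≤ C := (norm_nonneg _).trans (hC 0 (by simp))
  set v := volume.real (Metric.closedBall (0 : E3) 1)
  have hv : 0 < v := ENNReal.toReal_pos
    (Metric.measure_closedBall_pos _ _ one_pos).ne' (isCompact_closedBall _ _).measure_lt_top.ne
  filter_upwards [IsUnifLocDoublingMeasure.ae_tendsto_average_norm_sub volume hp 1] with x hx
  have hlim := hx (fun _ : ℕ => x) r (tendsto_nhdsWithin_iff.2 ⟨hr0, Eventually.of_forall hr⟩)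
    (Eventually.of_forall fun n => by simpa using (hr n).le)
  have key := tendsto_integral_smul_of_tendsto_average_norm_sub (f := p) (c := p x)
    (a := fun n => Metric.closedBall x (r n))
    (g := fun n y => c⁻¹ * (r n ^ 3)⁻¹ * h (‖y - x‖ / r n)) (|c⁻¹| * C * v) hlim
    (Eventually.of_forall fun n => hp.integrableOn_isCompact (isCompact_closedBall _ _)) ?_
    (Eventually.of_forall fun n y hy => ?_) (Eventually.of_forall fun n y => ?_)
  · have := key.const_mul c
    refine this.congr fun n => ?_
    rw [← integral_const_mul, ← integral_const_mul]
    refine integral_congr_ae (Eventually.of_forall fun y => ?_)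
    simp only [smul_eq_mul]
    field_simp
  · refine tendsto_const_nhds.congr fun n => ?_
    rw [integral_const_mul, integral_sub_right_eq_self (fun y : E3 => h (‖y‖ / r n)) x]
    have := Measure.integral_comp_inv_smul_of_nonneg (volume : Measure E3)
      (fun y : E3 => h ‖y‖) (hr n).le
    simp only [norm_smul, norm_inv, Real.norm_eq_abs, abs_of_pos (hr n), inv_mul_eq_div,
      finrank_euclideanSpace, Fintype.card_fin, smul_eq_mul] at this
    rw [this]
    have := (hr n).ne'
    field_simp
    rfl
  · by_contra hy2
    rw [Metric.mem_closedBall, dist_eq_norm, not_le] at hy2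
    exact hy (by simp [h1 _ ((one_le_div (hr n)).2 hy2.le)])
  · have hvol : volume.real (Metric.closedBall x (r n)) = r n ^ 3 * v := by
      have := Measure.addHaar_real_closedBall' (volume : Measure E3) x (hr n).le
      simpa using this
    rw [hvol, abs_mul, abs_mul, abs_of_pos (inv_pos.2 (pow_pos (hr n) 3))]
    have := hb (‖y - x‖ / r n) (by have := hr n; positivity)
    calc |c⁻¹| * (r n ^ 3)⁻¹ * |h (‖y - x‖ / r n)| ≤ |c⁻¹| * (r n ^ 3)⁻¹ * C := by
          have := hr n
          gcongr
      _ = _ := by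
          have := (hr n).ne'
          field_simp

end radialAverages

/-! ### Bounds and cancellations of the Hessian kernel -/

section kernelFacts

variable {Ψ : E3 → ℝ}

lemma hasCompactSupport_of_two_le (hΨ0 : ∀ z, 2 ≤ ‖z‖ → Ψ z = 0) : HasCompactSupport Ψ := by
  refine HasCompactSupport.intro (isCompact_closedBall (0 : E3) 2) fun z hz => hΨ0 z ?_
  simpa using (not_le.1 (by simpa using hz : ¬ ‖z‖ ≤ 2)).le

lemma hasCompactSupport_comp_smul_sub {F : Type*} [NormedAddCommGroup F] {f : E3 → F}
    (hf : HasCompactSupport f) {c : ℝ} (hc : c ≠ 0) (x : E3) :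
    HasCompactSupport fun y => f (c • (y - x)) :=
  hf.comp_homeomorph ((Homeomorph.subRight x).trans (Homeomorph.smulOfNeZero c hc))

lemma contDiff_comp_smul_sub {F : Type*} [NormedAddCommGroup F] [NormedSpace ℝ F] {f : E3 → F}
    (hf : ContDiff ℝ ∞ f) (c : ℝ) (x : E3) : ContDiff ℝ ∞ fun y => f (c • (y - x)) :=
  hf.comp ((contDiff_id.sub contDiff_const).const_smul c)

lemma hessian_eq_zero (hΨ0 : ∀ z, 2 ≤ ‖z‖ → Ψ z = 0) {z : E3} (hz : 2 < ‖z‖) :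
    fderiv ℝ (fderiv ℝ Ψ) z = 0 := by
  have h1 : Ψ =ᶠ[𝓝 z] fun _ => 0 := by
    filter_upwards [(isOpen_lt continuous_const continuous_norm).mem_nhds hz] with y hy
    exact hΨ0 y (le_of_lt hy)
  have h2 : fderiv ℝ (fderiv ℝ Ψ) z = fderiv ℝ (fderiv ℝ fun _ : E3 => (0 : ℝ)) z :=
    h1.fderiv.fderiv_eq
  rw [h2]
  have h3 : fderiv ℝ (fun _ : E3 => (0 : ℝ)) = fun _ => 0 := by
    funext y
    simp
  rw [h3]
  simp

lemma exists_hessian_bounds (hΨ : ContDiff ℝ ∞ Ψ) (hΨ0 : ∀ z, 2 ≤ ‖z‖ → Ψ z = 0) :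
    ∃ M : ℝ, 0 ≤ M ∧ (∀ z, ‖fderiv ℝ (fderiv ℝ Ψ) z‖ ≤ M) ∧
      ∀ z z', ‖fderiv ℝ (fderiv ℝ Ψ) z - fderiv ℝ (fderiv ℝ Ψ) z'‖ ≤ M * ‖z - z'‖ := by
  have hc := ((hasCompactSupport_of_two_le hΨ0).fderiv ℝ).fderiv ℝ
  have hs := contDiff_fderiv (contDiff_fderiv hΨ)
  obtain ⟨M1, h1⟩ : ∃ C, ∀ x, ‖fderiv ℝ (fderiv ℝ Ψ) x‖ ≤ C := by
    exact Continuous.bounded_above_of_compact_support (E := E3 →L[ℝ] E3 →L[ℝ] ℝ) hs.continuous hc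
  obtain ⟨M2, h2⟩ : ∃ C, LipschitzWith C (fderiv ℝ (fderiv ℝ Ψ)) :=
    ContDiff.lipschitzWith_of_hasCompactSupport (F' := E3 →L[ℝ] E3 →L[ℝ] ℝ) hc hs (by simp)
  refine ⟨max M1 M2, le_max_of_le_right M2.2, fun z => (h1 z).trans (le_max_left _ _),
    fun z z' => ?_⟩
  have := h2.dist_le_mul z z'
  rw [dist_eq_norm, dist_eq_norm] at this
  refine this.trans ?_
  gcongr
  exact le_max_right _ _

/-- The scalar test function `∂ₐΨ` (rescaled) yields both cancellations of the kernel: in the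
divergence-free condition it gives zero integral against `(u, a)`, and integrated by itself it gives
zero integral against constants. -/
lemma fderiv_test (hΨ : ContDiff ℝ ∞ Ψ) (c : ℝ) (x y a w : E3) :
    fderiv ℝ (fun y => fderiv ℝ Ψ (c • (y - x)) a) y w
      = c * fderiv ℝ (fderiv ℝ Ψ) (c • (y - x)) w a := by
  have d := (contDiff_fderiv hΨ).differentiable (by simp)
  have d' : Differentiable ℝ (fun y => fderiv ℝ Ψ (c • (y - x))) := by fun_prop
  have h3 := fderiv_comp_smul_sub (F := E3 →L[ℝ] ℝ) d c x y
  rw [fderiv_apply_const (k := fun y => fderiv ℝ Ψ (c • (y - x))) (d' y) a w, h3]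
  rfl

lemma contDiff_test (hΨ : ContDiff ℝ ∞ Ψ) (c : ℝ) (x a : E3) :
    ContDiff ℝ ∞ fun y => fderiv ℝ Ψ (c • (y - x)) a :=
  (contDiff_comp_smul_sub (contDiff_fderiv hΨ) c x).clm_apply contDiff_const

lemma hasCompactSupport_test (hΨ0 : ∀ z, 2 ≤ ‖z‖ → Ψ z = 0) {c : ℝ} (hc : c ≠ 0) (x a : E3) :
    HasCompactSupport fun y => fderiv ℝ Ψ (c • (y - x)) a :=
  hasCompactSupport_comp_smul_sub (f := fun z => fderiv ℝ Ψ z a)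
    ((hasCompactSupport_of_two_le hΨ0).fderiv_apply ℝ a) hc x

lemma integral_fderiv_apply_eq_zero {f : E3 → ℝ} (hf : ContDiff ℝ ∞ f) (hc : HasCompactSupport f)
    (a : E3) : ∫ y, fderiv ℝ f y a = 0 := by
  have i1 : Integrable f := hf.continuous.integrable_of_hasCompactSupport hc
  have i2 : Integrable fun y => fderiv ℝ f y a :=
    ((contDiff_fderiv hf).clm_apply contDiff_const).continuous.integrable_of_hasCompactSupport
      (hc.fderiv_apply ℝ a)
  have := integral_mul_fderiv_eq_neg_fderiv_mul_of_integrable (μ := (volume : Measure E3))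
    (f := fun _ => (1 : ℝ)) (g := f) (v := a) (by simp) (by simpa using i2) (by simpa using i1)
    (fun _ _ => differentiableAt_const _) (fun x _ => hf.differentiable (by simp) x)
  simpa using this

lemma integral_hessian_apply_eq_zero (hΨ : ContDiff ℝ ∞ Ψ) (hΨ0 : ∀ z, 2 ≤ ‖z‖ → Ψ z = 0) {c : ℝ}
    (hc : c ≠ 0) (x a b : E3) : ∫ y, fderiv ℝ (fderiv ℝ Ψ) (c • (y - x)) a b = 0 := by
  have := integral_fderiv_apply_eq_zero (contDiff_test hΨ c x b) (hasCompactSupport_test hΨ0 hc x b) a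
  simp only [fderiv_test hΨ] at this
  rw [integral_const_mul] at this
  exact (mul_eq_zero.1 this).resolve_left hc

end kernelFacts

/-! ### Size and variation of one dyadic increment -/

lemma integrable_quadratic {K : E3 → E3 →L[ℝ] E3 →L[ℝ] ℝ} (hK : Continuous K) {x : E3} {R : ℝ}
    (hK0 : ∀ y, R < ‖y - x‖ → K y = 0) {f g : E3 → E3} (hf : Continuous f) (hg : Continuous g) :
    Integrable fun y => K y (f y) (g y) := by
  refine Continuous.integrable_of_hasCompactSupport ((hK.clm_apply hf).clm_apply hg) ?_
  refine HasCompactSupport.intro (isCompact_closedBall x R) fun y hy => ?_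
  rw [Metric.mem_closedBall, dist_eq_norm, not_le] at hy
  simp [hK0 y hy]

/-- When the square is expanded, the cross terms vanish by incompressibility (`h1`) and the constant
term by the zero mean of the kernel (`h0`). This is what doubles the Hölder exponent. -/
lemma integral_quadratic_sub_const {K : E3 → E3 →L[ℝ] E3 →L[ℝ] ℝ} (hK : Continuous K) {x : E3}
    {R : ℝ} (hK0 : ∀ y, R < ‖y - x‖ → K y = 0) (hsymm : ∀ y a b, K y a b = K y b a)
    (h0 : ∀ a b, ∫ y, K y a b = 0) {v : E3 → E3} (hv : Continuous v)
    (h1 : ∀ a, ∫ y, K y (v y) a = 0) (a : E3) :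
    ∫ y, K y (v y - a) (v y - a) = ∫ y, K y (v y) (v y) := by
  have i1 := integrable_quadratic hK hK0 hv hv
  have i2 := integrable_quadratic hK hK0 hv (continuous_const (y := a))
  have i3 := integrable_quadratic hK hK0 (continuous_const (y := a)) (continuous_const (y := a))
  have e : ∀ y, K y (v y - a) (v y - a) = K y (v y) (v y) - 2 * K y (v y) a + K y a a := by
    intro y
    simp only [map_sub, sub_apply]
    rw [hsymm y a (v y)]
    ring
  have i4 : Integrable fun y => K y (v y) (v y) - 2 * K y (v y) a := i1.sub (i2.const_mul 2)
  simp only [e]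
  rw [integral_add i4 i3, integral_sub i1 (i2.const_mul 2),
    integral_const_mul, h1, h0]
  ring

/-- The support radius is `3r` rather than `2r` so that `G` may also be a difference of two kernels
with centres at distance at most `r`. The constant is `243 = 27 · 9`: the volume of the ball gives
`3³`, and `(3^α)² ≤ 9`. -/
lemma abs_integral_quadratic_le_of_holder {G : E3 → E3 →L[ℝ] E3 →L[ℝ] ℝ} {m r : ℝ} (hr : 0 < r)
    (x : E3) (hG : ∀ y, ‖G y‖ ≤ m) (hG0 : ∀ y, 3 * r < ‖y - x‖ → G y = 0)
    {v : E3 → E3} {α A : ℝ≥0} (hα : α ≤ 1) (hv : HolderWith A α v) :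
    (r ^ 3)⁻¹ * |∫ y, G y (v y - v x) (v y - v x)|
      ≤ 243 * volume.real (Metric.ball (0 : E3) 1) * m * (A ^ 2 * r ^ (2 * α : ℝ)) := by
  set w := volume.real (Metric.ball (0 : E3) 1)
  have hm : 0 ≤ m := (norm_nonneg (G 0)).trans (hG 0)
  have hsupp : ∀ y ∉ Metric.closedBall x (3 * r), G y (v y - v x) (v y - v x) = 0 := by
    intro y hy
    rw [Metric.mem_closedBall, dist_eq_norm, not_le] at hy
    simp [hG0 y hy]
  rw [← setIntegral_eq_integral_of_forall_compl_eq_zero hsupp]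
  have hb : ∀ y ∈ Metric.closedBall x (3 * r), ‖G y (v y - v x) (v y - v x)‖
      ≤ m * (9 * (A ^ 2 * r ^ (2 * α : ℝ))) := by
    intro y hy
    rw [Metric.mem_closedBall] at hy
    have h1 := hv.dist_le y x
    rw [dist_eq_norm] at h1
    have h2 : ‖v y - v x‖ ≤ A * (3 * r ^ (α : ℝ)) := by
      refine h1.trans ?_
      gcongr
      calc dist y x ^ (α : ℝ) ≤ (3 * r) ^ (α : ℝ) := by gcongr
        _ = 3 ^ (α : ℝ) * r ^ (α : ℝ) := Real.mul_rpow (by norm_num) hr.le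
        _ ≤ 3 * r ^ (α : ℝ) := by
          gcongr
          calc (3 : ℝ) ^ (α : ℝ) ≤ 3 ^ (1 : ℝ) :=
                Real.rpow_le_rpow_of_exponent_le (by norm_num) (by exact_mod_cast hα)
            _ = 3 := Real.rpow_one 3
    refine (ContinuousLinearMap.le_opNorm₂ _ _ _).trans ?_
    rw [mul_assoc]
    have h3 : r ^ (2 * α : ℝ) = r ^ (α : ℝ) * r ^ (α : ℝ) := by
      rw [← Real.rpow_add hr]
      ring_nf
    have h4 : ‖v y - v x‖ * ‖v y - v x‖ ≤ (A * (3 * r ^ (α : ℝ))) * (A * (3 * r ^ (α : ℝ))) := by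
      gcongr
    refine mul_le_mul (hG y) (h4.trans (le_of_eq ?_)) (by positivity) hm
    rw [h3]
    ring
  have h5 := norm_setIntegral_le_of_norm_le_const (μ := volume)
    (isCompact_closedBall x (3 * r)).measure_lt_top hb
  have hvol : volume.real (Metric.closedBall x (3 * r)) = (3 * r) ^ 3 * w := by
    rw [Measure.addHaar_real_closedBall_eq_addHaar_real_ball, volume_real_ball x (by positivity)]
  rw [hvol, Real.norm_eq_abs] at h5
  calc (r ^ 3)⁻¹ * |∫ y in Metric.closedBall x (3 * r), G y (v y - v x) (v y - v x)|
      ≤ (r ^ 3)⁻¹ * (m * (9 * (A ^ 2 * r ^ (2 * α : ℝ))) * ((3 * r) ^ 3 * w)) := by gcongr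
    _ = _ := by
      field_simp
      ring

lemma abs_integral_quadratic_le_of_memLp {G : E3 → E3 →L[ℝ] E3 →L[ℝ] ℝ} {m : ℝ}
    (hG : ∀ y, ‖G y‖ ≤ m) {v : E3 → E3} (hv : Integrable fun y => ‖v y‖ ^ 2) :
    |∫ y, G y (v y) (v y)| ≤ m * ∫ y, ‖v y‖ ^ 2 := by
  rw [← integral_const_mul, ← Real.norm_eq_abs]
  refine norm_integral_le_of_norm_le (hv.const_mul m) (Eventually.of_forall fun y => ?_)
  refine (ContinuousLinearMap.le_opNorm₂ _ _ _).trans ?_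
  rw [mul_assoc, ← sq]
  gcongr
  exact hG y

/-- The mean of `p` around `x` at scale `r`, with radial profile `h`. -/
noncomputable def radialMean (h : ℝ → ℝ) (p : E3 → ℝ) (r : ℝ) (x : E3) : ℝ :=
  (r ^ 3)⁻¹ * ∫ y, h (‖y - x‖ / r) * p y

/-- The quadratic expression in the velocity that equals the increment of the radial means of the
pressure between the scales `r` and `2r`. -/
noncomputable def quadMean (Ψ : E3 → ℝ) (v : E3 → E3) (r : ℝ) (x : E3) : ℝ :=
  (r ^ 3)⁻¹ * ∫ y, fderiv ℝ (fderiv ℝ Ψ) (r⁻¹ • (y - x)) (v y) (v y)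

section increments

variable {Ψ : E3 → ℝ} {v : E3 → E3} {r : ℝ} {α A : ℝ≥0} {M : ℝ}

lemma continuous_hessian_comp (hΨ : ContDiff ℝ ∞ Ψ) (c : ℝ) (x : E3) :
    Continuous fun y => fderiv ℝ (fderiv ℝ Ψ) (c • (y - x)) :=
  (contDiff_comp_smul_sub (contDiff_fderiv (contDiff_fderiv hΨ)) c x).continuous

lemma hessian_scaled_eq_zero (hΨ0 : ∀ z, 2 ≤ ‖z‖ → Ψ z = 0) (hr : 0 < r) {x y : E3}
    (h : 2 * r < ‖y - x‖) : fderiv ℝ (fderiv ℝ Ψ) (r⁻¹ • (y - x)) = 0 := by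
  refine hessian_eq_zero hΨ0 ?_
  rw [norm_smul, norm_inv, Real.norm_eq_abs, abs_of_pos hr, inv_mul_eq_div, lt_div_iff₀ hr]
  exact h

lemma quadMean_eq_sub_const (hΨ : ContDiff ℝ ∞ Ψ) (hΨ0 : ∀ z, 2 ≤ ‖z‖ → Ψ z = 0) (hr : 0 < r)
    (hv : Continuous v) (x : E3)
    (hdiv : ∀ a, ∫ y, fderiv ℝ (fderiv ℝ Ψ) (r⁻¹ • (y - x)) (v y) a = 0) (a : E3) :
    quadMean Ψ v r x
      = (r ^ 3)⁻¹ * ∫ y, fderiv ℝ (fderiv ℝ Ψ) (r⁻¹ • (y - x)) (v y - a) (v y - a) := by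
  have hr' : r⁻¹ ≠ 0 := (inv_pos.2 hr).ne'
  rw [quadMean, integral_quadratic_sub_const (continuous_hessian_comp hΨ _ _)
    (fun y hy => hessian_scaled_eq_zero hΨ0 hr hy)
    (fun y a b => (hΨ.contDiffAt.isSymmSndFDerivAt (by simpa using two_le_infty)).eq a b)
    (integral_hessian_apply_eq_zero hΨ hΨ0 hr' x) hv hdiv a]

lemma integrable_hessian_quadratic (hΨ : ContDiff ℝ ∞ Ψ) (hΨ0 : ∀ z, 2 ≤ ‖z‖ → Ψ z = 0)
    (hr : 0 < r) (hv : Continuous v) (x : E3) :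
    Integrable fun y => fderiv ℝ (fderiv ℝ Ψ) (r⁻¹ • (y - x)) (v y) (v y) :=
  integrable_quadratic (continuous_hessian_comp hΨ _ _)
    (fun _ hy => hessian_scaled_eq_zero hΨ0 hr hy) hv hv

lemma hessian_scaled_sub_le (hr : 0 < r)
    (hM : ∀ z z', ‖fderiv ℝ (fderiv ℝ Ψ) z - fderiv ℝ (fderiv ℝ Ψ) z'‖ ≤ M * ‖z - z'‖)
    (x x' y : E3) :
    ‖fderiv ℝ (fderiv ℝ Ψ) (r⁻¹ • (y - x)) - fderiv ℝ (fderiv ℝ Ψ) (r⁻¹ • (y - x'))‖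
      ≤ M * (dist x x' / r) := by
  refine (hM _ _).trans (le_of_eq ?_)
  rw [← smul_sub, sub_sub_sub_cancel_left, norm_smul, norm_inv, Real.norm_eq_abs, abs_of_pos hr,
    inv_mul_eq_div, dist_comm, dist_eq_norm]

lemma abs_quadMean_le_of_holder (hΨ : ContDiff ℝ ∞ Ψ) (hΨ0 : ∀ z, 2 ≤ ‖z‖ → Ψ z = 0) (hr : 0 < r)
    (hM : ∀ z, ‖fderiv ℝ (fderiv ℝ Ψ) z‖ ≤ M) (hα0 : 0 < α) (hα : α ≤ 1) (hv : HolderWith A α v)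
    (x : E3) (hdiv : ∀ a, ∫ y, fderiv ℝ (fderiv ℝ Ψ) (r⁻¹ • (y - x)) (v y) a = 0) :
    |quadMean Ψ v r x|
      ≤ 243 * volume.real (Metric.ball (0 : E3) 1) * M * (A ^ 2 * r ^ (2 * α : ℝ)) := by
  rw [quadMean_eq_sub_const hΨ hΨ0 hr (hv.continuous hα0) x hdiv (v x), abs_mul,
    abs_of_pos (by positivity)]
  exact abs_integral_quadratic_le_of_holder hr x (fun y => hM _)
    (fun y hy => hessian_scaled_eq_zero hΨ0 hr (by linarith)) hα hv

/-- The same constant `v x` is subtracted at both centres; then only the kernels differ, and their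
difference is `O(|x-x'|/r)`. -/
lemma abs_quadMean_sub_le_of_holder (hΨ : ContDiff ℝ ∞ Ψ) (hΨ0 : ∀ z, 2 ≤ ‖z‖ → Ψ z = 0)
    (hr : 0 < r)
    (hM : ∀ z z', ‖fderiv ℝ (fderiv ℝ Ψ) z - fderiv ℝ (fderiv ℝ Ψ) z'‖ ≤ M * ‖z - z'‖)
    (hα0 : 0 < α) (hα : α ≤ 1) (hv : HolderWith A α v) (x x' : E3)
    (hdiv : ∀ x a, ∫ y, fderiv ℝ (fderiv ℝ Ψ) (r⁻¹ • (y - x)) (v y) a = 0) (hx : dist x x' ≤ r) :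
    |quadMean Ψ v r x - quadMean Ψ v r x'|
      ≤ 243 * volume.real (Metric.ball (0 : E3) 1) * (M * (dist x x' / r))
        * (A ^ 2 * r ^ (2 * α : ℝ)) := by
  have hc := hv.continuous hα0
  have hc' : Continuous fun y => v y - v x := hc.sub continuous_const
  rw [quadMean_eq_sub_const hΨ hΨ0 hr hc x (hdiv x) (v x),
    quadMean_eq_sub_const hΨ hΨ0 hr hc x' (hdiv x') (v x), ← mul_sub,
    ← integral_sub (integrable_hessian_quadratic hΨ hΨ0 hr hc' x)
      (integrable_hessian_quadratic hΨ hΨ0 hr hc' x'), abs_mul, abs_of_pos (by positivity)]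
  refine abs_integral_quadratic_le_of_holder hr x (fun y => hessian_scaled_sub_le hr hM x x' y)
    (fun y hy => ?_) hα hv
  have h1 : ‖y - x‖ ≤ ‖y - x'‖ + dist x x' := by
    rw [← dist_eq_norm, ← dist_eq_norm, dist_comm x x']
    exact dist_triangle _ _ _
  rw [hessian_scaled_eq_zero hΨ0 hr (by linarith), hessian_scaled_eq_zero hΨ0 hr (by linarith),
    sub_zero]

lemma abs_quadMean_le_of_memLp (hr : 0 < r) (hM : ∀ z, ‖fderiv ℝ (fderiv ℝ Ψ) z‖ ≤ M)
    (hv : Integrable fun y => ‖v y‖ ^ 2) (x : E3) :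
    |quadMean Ψ v r x| ≤ (r ^ 3)⁻¹ * (M * ∫ y, ‖v y‖ ^ 2) := by
  rw [quadMean, abs_mul, abs_of_pos (by positivity)]
  gcongr
  exact abs_integral_quadratic_le_of_memLp (fun y => hM _) hv

lemma abs_quadMean_sub_le_of_memLp (hΨ : ContDiff ℝ ∞ Ψ) (hΨ0 : ∀ z, 2 ≤ ‖z‖ → Ψ z = 0)
    (hr : 0 < r)
    (hM : ∀ z z', ‖fderiv ℝ (fderiv ℝ Ψ) z - fderiv ℝ (fderiv ℝ Ψ) z'‖ ≤ M * ‖z - z'‖)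
    (hc : Continuous v) (hv : Integrable fun y => ‖v y‖ ^ 2) (x x' : E3) :
    |quadMean Ψ v r x - quadMean Ψ v r x'|
      ≤ (r ^ 3)⁻¹ * (M * (dist x x' / r) * ∫ y, ‖v y‖ ^ 2) := by
  rw [quadMean, quadMean, ← mul_sub, ← integral_sub (integrable_hessian_quadratic hΨ hΨ0 hr hc x)
      (integrable_hessian_quadratic hΨ hΨ0 hr hc x'), abs_mul, abs_of_pos (by positivity)]
  gcongr
  exact abs_integral_quadratic_le_of_memLp (fun y => hessian_scaled_sub_le hr hM x x' y) hv

end increments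

/-! ### Summation over dyadic scales -/

section dyadic

/-- Summation of the dyadic increments `D` of a function `I` of a scale and a point. -/
theorem exists_limit_of_dyadic_increments {I D : ℝ → E3 → ℝ} {a L ρ : ℝ} (ha : 0 ≤ a)
    (hρ0 : 0 < ρ) (hρ : ρ < 1)
    (hID : ∀ (k : ℤ) x, I ((2 : ℝ) ^ k) x - I (2 * (2 : ℝ) ^ k) x = - D ((2 : ℝ) ^ k) x)
    (hI : ∀ x, Tendsto (fun m : ℕ => I ((2 : ℝ) ^ m) x) atTop (𝓝 0))
    (h1 : ∀ (n : ℕ) x, |D ((1 / 2 : ℝ) ^ n) x| ≤ a * ρ ^ n)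
    (h2 : ∀ (n : ℕ) x x', dist x x' ≤ (1 / 2 : ℝ) ^ n →
      |D ((1 / 2 : ℝ) ^ n) x - D ((1 / 2 : ℝ) ^ n) x'| ≤ a * (dist x x' * (2 * ρ) ^ n))
    (h3 : ∀ (m : ℕ) x, |D ((2 : ℝ) ^ m) x| ≤ L * (1 / 2) ^ m)
    (h4 : ∀ (m : ℕ) x x', |D ((2 : ℝ) ^ m) x - D ((2 : ℝ) ^ m) x'| ≤ L * dist x x' * (1 / 2) ^ m) :
    ∃ P : E3 → ℝ, (∀ x, Tendsto (fun n : ℕ => I ((1 / 2 : ℝ) ^ n) x) atTop (𝓝 (P x))) ∧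
      (∀ x, |P x| ≤ a / (1 - ρ) + 2 * L) ∧
      ∀ x x' (N : ℕ), dist x x' ≤ (1 / 2 : ℝ) ^ N → |P x - P x'| ≤
        2 * (a * ρ ^ N / (1 - ρ)) + a * (dist x x' * ∑ n ∈ Finset.range N, (2 * ρ) ^ (n + 1))
          + 2 * L * dist x x' := by
  have hJ : ∀ (n : ℕ) x, I ((1 / 2 : ℝ) ^ (n + 1)) x - I ((1 / 2 : ℝ) ^ n) x
      = - D ((1 / 2 : ℝ) ^ (n + 1)) x := by
    intro n x
    have h := hID (-((n + 1 : ℕ) : ℤ)) x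
    have e1 : (2 : ℝ) ^ (-((n + 1 : ℕ) : ℤ)) = (1 / 2) ^ (n + 1) := by
      rw [zpow_neg, zpow_natCast, one_div, inv_pow]
    have e2 : 2 * (1 / 2 : ℝ) ^ (n + 1) = (1 / 2) ^ n := by
      rw [pow_succ]
      ring
    rwa [e1, e2] at h
  have hK : ∀ (m : ℕ) x, I ((2 : ℝ) ^ m) x - I ((2 : ℝ) ^ (m + 1)) x = - D ((2 : ℝ) ^ m) x := by
    intro m x
    have h := hID m x
    rwa [zpow_natCast, show 2 * (2 : ℝ) ^ m = 2 ^ (m + 1) by ring] at h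
  have hgeo : ∀ x (n : ℕ), dist (I ((1 / 2 : ℝ) ^ n) x) (I ((1 / 2 : ℝ) ^ (n + 1)) x) ≤ a * ρ ^ n := by
    intro x n
    rw [dist_comm, Real.dist_eq, hJ, abs_neg]
    refine (h1 (n + 1) x).trans ?_
    have := pow_le_pow_of_le_one hρ0.le hρ.le (Nat.le_succ n)
    gcongr
  have hlim : ∀ x, ∃ l, Tendsto (fun n : ℕ => I ((1 / 2 : ℝ) ^ n) x) atTop (𝓝 l) := fun x =>
    cauchySeq_tendsto_of_complete (cauchySeq_of_le_geometric ρ a hρ (hgeo x))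
  choose P hP using hlim
  have hdist : ∀ x (n : ℕ), |I ((1 / 2 : ℝ) ^ n) x - P x| ≤ a * ρ ^ n / (1 - ρ) := fun x n =>
    dist_le_of_le_geometric_of_tendsto ρ a hρ (hgeo x) (hP x) n
  -- The coarse scales are summed from infinity, where the mean is zero, down to scale `1`.
  have hone : ∀ x, |I 1 x| ≤ 2 * L := by
    intro x
    have := dist_le_of_le_geometric_of_tendsto₀ (1 / 2) L (by norm_num)
      (f := fun m : ℕ => I ((2 : ℝ) ^ m) x) (fun m => by
        rw [Real.dist_eq, hK, abs_neg]
        exact h3 m x) (hI x)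
    rw [dist_zero_right, pow_zero, Real.norm_eq_abs, show (1 : ℝ) - 1 / 2 = 1 / 2 by norm_num] at this
    linarith
  have hone' : ∀ x x', |I 1 x - I 1 x'| ≤ 2 * L * dist x x' := by
    intro x x'
    have := dist_le_of_le_geometric_of_tendsto₀ (1 / 2) (L * dist x x') (by norm_num)
      (f := fun m : ℕ => I ((2 : ℝ) ^ m) x - I ((2 : ℝ) ^ m) x') (fun m => by
        rw [Real.dist_eq, show I ((2 : ℝ) ^ m) x - I ((2 : ℝ) ^ m) x'
          - (I ((2 : ℝ) ^ (m + 1)) x - I ((2 : ℝ) ^ (m + 1)) x')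
          = (I ((2 : ℝ) ^ m) x - I ((2 : ℝ) ^ (m + 1)) x)
            - (I ((2 : ℝ) ^ m) x' - I ((2 : ℝ) ^ (m + 1)) x') by ring, hK, hK, ← neg_sub',
          abs_neg]
        exact h4 m x x') (by simpa using (hI x).sub (hI x'))
    rw [dist_zero_right, pow_zero, Real.norm_eq_abs, show (1 : ℝ) - 1 / 2 = 1 / 2 by norm_num] at this
    linarith
  -- Only the scales `1/2, …, (1/2)^N`, all at least `|x-x'|`, are summed with the variation bound
  -- `h2`. The finer ones are left to `hdist`, applied at each point separately.
  have hmid : ∀ x x' (N : ℕ), dist x x' ≤ (1 / 2 : ℝ) ^ N →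
      |(I ((1 / 2 : ℝ) ^ N) x - I ((1 / 2 : ℝ) ^ N) x')| ≤
        |I 1 x - I 1 x'| + a * (dist x x' * ∑ n ∈ Finset.range N, (2 * ρ) ^ (n + 1)) := by
    intro x x' N hN
    induction N with
    | zero => simp
    | succ N ih =>
      have hN' : dist x x' ≤ (1 / 2 : ℝ) ^ N :=
        hN.trans (pow_le_pow_of_le_one (by norm_num) (by norm_num) (Nat.le_succ N))
      have h5 := ih hN'
      have h6 := h2 (N + 1) x x' hN
      have h7 : I ((1 / 2 : ℝ) ^ (N + 1)) x - I ((1 / 2 : ℝ) ^ (N + 1)) x'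
          = (I ((1 / 2 : ℝ) ^ N) x - I ((1 / 2 : ℝ) ^ N) x')
            - (D ((1 / 2 : ℝ) ^ (N + 1)) x - D ((1 / 2 : ℝ) ^ (N + 1)) x') := by
        linarith [hJ N x, hJ N x']
      rw [h7, Finset.sum_range_succ]
      refine (abs_sub _ _).trans ?_
      linarith
  refine ⟨P, hP, fun x => ?_, fun x x' N hN => ?_⟩
  · have h5 := hdist x 0
    have h6 := hone x
    rw [pow_zero, pow_zero, mul_one] at h5
    rw [abs_le] at *
    constructor <;> linarith
  · have h5 := hdist x N
    have h6 := hdist x' N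
    have h7 := hmid x x' N hN
    have h8 := hone' x x'
    have h9 : |P x - P x'| ≤ |I ((1 / 2 : ℝ) ^ N) x - P x| + |I ((1 / 2 : ℝ) ^ N) x' - P x'|
        + |I ((1 / 2 : ℝ) ^ N) x - I ((1 / 2 : ℝ) ^ N) x'| := by
      have e : P x - P x' = -(I ((1 / 2 : ℝ) ^ N) x - P x) + (I ((1 / 2 : ℝ) ^ N) x' - P x')
        + (I ((1 / 2 : ℝ) ^ N) x - I ((1 / 2 : ℝ) ^ N) x') := by ring
      rw [e]
      refine (abs_add_three _ _ _).trans ?_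
      rw [abs_neg]
    linarith

end dyadic

/-- `P` is bounded by `B`, with the increments that arise from summing dyadic pieces of decay
rate `ρ`. -/
def HasDyadicModulus (ρ B : ℝ) (P : E3 → ℝ) : Prop :=
  (∀ x, |P x| ≤ B) ∧ ∀ x x' (N : ℕ), dist x x' ≤ (1 / 2 : ℝ) ^ N → |P x - P x'| ≤
    B * (ρ ^ N + dist x x' * ∑ n ∈ Finset.range N, (2 * ρ) ^ (n + 1) + dist x x')

lemma half_rpow_pow (β : ℝ) (n : ℕ) : (((1 : ℝ) / 2) ^ n) ^ β = (((1 : ℝ) / 2) ^ β) ^ n := by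
  rw [← Real.rpow_natCast, ← Real.rpow_natCast, ← Real.rpow_mul (by norm_num),
    ← Real.rpow_mul (by norm_num), mul_comm]

lemma sup_bound_arith {c M s : ℝ} (hc : 0 ≤ c) (hM : 0 ≤ M) (hs : 0 ≤ c / s) (a L : ℝ)
    (ha : 0 ≤ a) (hL : 0 ≤ L) :
    c * a / s + 2 * (M * L) ≤ (2 * (c / s) + c + 2 * M) * (a + L) := by
  have : 0 ≤ (c / s + c + 2 * M) * a + (2 * (c / s) + c) * L := by positivity
  have e : c * a / s = c / s * a := by ring
  rw [e]
  linarith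

lemma increment_bound_arith {c M s : ℝ} (hc : 0 ≤ c) (hM : 0 ≤ M) (hs : 0 ≤ c / s) (a L : ℝ)
    (ha : 0 ≤ a) (hL : 0 ≤ L) {b d S : ℝ} (hb : 0 ≤ b) (hd : 0 ≤ d) (hS : 0 ≤ S) :
    2 * (c * a * b / s) + c * a * (d * S) + 2 * (M * L) * d
      ≤ (2 * (c / s) + c + 2 * M) * ((a + L) * (b + d * S + d)) := by
  generalize hq : c / s = q at *
  have e : c * a * b / s = q * a * b := by
    rw [← hq]
    ring
  have : 0 ≤ (c + 2 * M) * a * b + (2 * q + 2 * M) * a * (d * S)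
      + (2 * q + c + 2 * M) * a * d + (2 * q + c + 2 * M) * L * (b + d * S)
      + (2 * q + c) * L * d := by
    positivity
  rw [e]
  linarith

/-- The fixed-time estimate: Hölder bounds feed the fine scales, energy bounds the coarse ones. `C`
depends only on the kernel and `α`, which is what permits integration in time. `P` is exhibited as a
limit of means, for measurability in time. -/
theorem exists_hasDyadicModulus {Ψ : E3 → ℝ} {h : ℝ → ℝ} (hΨ : ContDiff ℝ ∞ Ψ)
    (hΨ0 : ∀ z, 2 ≤ ‖z‖ → Ψ z = 0) (hh : ContDiff ℝ ∞ h) (h1 : ∀ r, 1 ≤ r → h r = 0)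
    (hc : ∫ z : E3, h ‖z‖ ≠ 0) {α : ℝ≥0} (hα0 : 0 < α) (hα : α ≤ 1) :
    ∃ C : ℝ≥0, ∀ (v : E3 → E3) (p : E3 → ℝ) (A : ℝ≥0), HolderWith A α v →
      Integrable (fun y => ‖v y‖ ^ 2) → LocallyIntegrable p →
      (∀ (k : ℤ) (x a : E3),
        ∫ y, fderiv ℝ (fderiv ℝ Ψ) (((2 : ℝ) ^ k)⁻¹ • (y - x)) (v y) a = 0) →
      (∀ (k : ℤ) (x : E3), radialMean h p ((2 : ℝ) ^ k) x - radialMean h p (2 * (2 : ℝ) ^ k) x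
        = - quadMean Ψ v ((2 : ℝ) ^ k) x) →
      (∀ x : E3, Tendsto (fun R : ℝ => ⨍ y in Metric.ball x R, p y) atTop (𝓝 0)) →
      ∃ P : E3 → ℝ, (∀ x, Tendsto (fun n : ℕ =>
          (∫ z : E3, h ‖z‖)⁻¹ * radialMean h p ((1 / 2 : ℝ) ^ n) x) atTop (𝓝 (P x))) ∧
        P =ᵐ[volume] p ∧
        HasDyadicModulus ((1 / 2 : ℝ) ^ (2 * α : ℝ)) (C * (A ^ 2 + ∫ y, ‖v y‖ ^ 2)) P := by
  obtain ⟨M, hM0, hM, hMlip⟩ := exists_hessian_bounds hΨ hΨ0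
  set c := ∫ z : E3, h ‖z‖
  set ρ : ℝ := (1 / 2 : ℝ) ^ (2 * α : ℝ) with hρdef
  have hαr : (0 : ℝ) < α := hα0
  have hρ0 : 0 < ρ := by positivity
  have hρ1 : ρ < 1 := Real.rpow_lt_one (by norm_num) (by norm_num) (by positivity)
  set w := volume.real (Metric.ball (0 : E3) 1)
  have hw : 0 ≤ w := measureReal_nonneg
  set c1 : ℝ := 243 * w * M
  have hc1 : 0 ≤ c1 := by positivity
  have h1ρ : 0 < 1 - ρ := by linarith
  set C0 : ℝ := 2 * (c1 / (1 - ρ)) + c1 + 2 * M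
  have hq : 0 ≤ c1 / (1 - ρ) := by positivity
  have hC0 : 0 ≤ C0 := by positivity
  refine ⟨⟨|c⁻¹| * C0, by positivity⟩, fun v p A hv hv2 hp hdiv hid hlim => ?_⟩
  set L := ∫ y, ‖v y‖ ^ 2
  have hL : 0 ≤ L := integral_nonneg fun _ => by positivity
  have hA : (0 : ℝ) ≤ A ^ 2 := by positivity
  have hz : ∀ n : ℕ, ((1 : ℝ) / 2) ^ n = (2 : ℝ) ^ (-(n : ℤ)) := fun n => by
    rw [zpow_neg, zpow_natCast, one_div, inv_pow]
  have hdn : ∀ (n : ℕ) (x a : E3),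
      ∫ y, fderiv ℝ (fderiv ℝ Ψ) (((1 / 2 : ℝ) ^ n)⁻¹ • (y - x)) (v y) a = 0 := fun n => by
    rw [hz]
    exact hdiv _
  obtain ⟨Q, hQ, hQ1, hQ2⟩ := exists_limit_of_dyadic_increments (I := radialMean h p)
    (D := quadMean Ψ v) (a := c1 * A ^ 2) (L := M * L) (ρ := ρ) (by positivity) hρ0 hρ1 hid
    (fun x => (tendsto_radial_atTop hh h1 hp x (hlim x)).comp
      (tendsto_pow_atTop_atTop_of_one_lt one_lt_two))
    (fun n x => by
      refine (abs_quadMean_le_of_holder hΨ hΨ0 (by positivity) hM hα0 hα hv x (hdn n x)).trans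
        (le_of_eq ?_)
      rw [half_rpow_pow]
      ring)
    (fun n x x' hx => by
      refine (abs_quadMean_sub_le_of_holder hΨ hΨ0 (by positivity) hMlip hα0 hα hv x x' (hdn n)
        hx).trans (le_of_eq ?_)
      rw [half_rpow_pow, one_div, inv_pow, div_inv_eq_mul, mul_pow, ← one_div]
      ring)
    -- The available decay `2^{-3m}` is weakened to the `2^{-m}` that the summation asks for.
    (fun m x => by
      refine (abs_quadMean_le_of_memLp (by positivity) hM hv2 x).trans ?_
      rw [mul_comm, one_div, inv_pow]
      gcongr
      rw [← pow_mul]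
      exact pow_le_pow_right₀ one_le_two (by omega))
    (fun m x x' => by
      refine (abs_quadMean_sub_le_of_memLp hΨ hΨ0 (by positivity) hMlip (hv.continuous hα0) hv2
        x x').trans ?_
      have e : ((2 : ℝ) ^ m ^ 1) = 2 ^ m := by simp
      have h2 : (((2 : ℝ) ^ m) ^ 3)⁻¹ * ((2 : ℝ) ^ m)⁻¹ ≤ (1 / 2) ^ m := by
        rw [one_div, inv_pow, ← mul_inv, ← pow_succ]
        gcongr
        rw [← pow_mul]
        exact pow_le_pow_right₀ one_le_two (by omega)
      calc (((2 : ℝ) ^ m) ^ 3)⁻¹ * (M * (dist x x' / 2 ^ m) * L)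
          = M * L * dist x x' * ((((2 : ℝ) ^ m) ^ 3)⁻¹ * ((2 : ℝ) ^ m)⁻¹) := by
            rw [div_eq_mul_inv]
            ring
        _ ≤ M * L * dist x x' * (1 / 2) ^ m := by gcongr)
  have hlimP : ∀ x, Tendsto (fun n : ℕ => c⁻¹ * radialMean h p ((1 / 2 : ℝ) ^ n) x) atTop
      (𝓝 (c⁻¹ * Q x)) := fun x => (hQ x).const_mul _
  refine ⟨fun x => c⁻¹ * Q x, hlimP, ?_, fun x => ?_, fun x x' N hN => ?_⟩
  · filter_upwards [ae_tendsto_radial hh h1 hp (r := fun n => (1 / 2 : ℝ) ^ n)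
      (fun n => by positivity) (tendsto_pow_atTop_nhds_zero_of_lt_one (by norm_num) (by norm_num))
      hc] with x hx
    rw [tendsto_nhds_unique (hQ x) hx, inv_mul_cancel_left₀ hc]
  · rw [abs_mul]
    change _ ≤ |c⁻¹| * C0 * _
    rw [mul_assoc]
    gcongr
    refine (hQ1 x).trans ?_
    exact sup_bound_arith hc1 hM0 hq (A ^ 2) L hA hL
  · rw [← mul_sub, abs_mul]
    change _ ≤ |c⁻¹| * C0 * _ * _
    rw [mul_assoc, mul_assoc]
    gcongr
    refine (hQ2 x x' N hN).trans ?_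
    exact increment_bound_arith hc1 hM0 hq (A ^ 2) L hA hL (by positivity) dist_nonneg
      (Finset.sum_nonneg fun _ _ => by positivity)

/-! ### From the dyadic modulus to the three norms -/

section moduli

variable {α : ℝ≥0}

lemma HasDyadicModulus.le_of_sum_le {ρ B : ℝ} (hB : 0 ≤ B) {P : E3 → ℝ}
    (hP : HasDyadicModulus ρ B P) {x x' : E3} {N : ℕ} (hN : dist x x' ≤ (1 / 2 : ℝ) ^ N) {η : ℝ}
    (hη : ρ ^ N + dist x x' * ∑ n ∈ Finset.range N, (2 * ρ) ^ (n + 1) + dist x x' ≤ η) :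
    |P x - P x'| ≤ B * η :=
  (hP.2 x x' N hN).trans (by gcongr)

/-- Take `(1/2)^(N+1) < d ≤ (1/2)^N`. Here `2ρ > 1`, so the geometric sum is comparable to its last
term, and `d (2ρ)^N ≤ ρ^N`, which is at most a constant times `d^{2α}`. -/
lemma exists_sum_le_rpow (hα0 : 0 < α) (hα : (α : ℝ) < 1 / 2) : ∃ K : ℝ, 0 ≤ K ∧ ∀ d : ℝ, 0 < d →
    d ≤ 1 → ∃ N : ℕ, d ≤ (1 / 2 : ℝ) ^ N ∧
      ((1 / 2 : ℝ) ^ (2 * α : ℝ)) ^ N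
        + d * ∑ n ∈ Finset.range N, (2 * (1 / 2 : ℝ) ^ (2 * α : ℝ)) ^ (n + 1) + d
      ≤ K * d ^ (2 * α : ℝ) := by
  set ρ : ℝ := (1 / 2 : ℝ) ^ (2 * α : ℝ) with hρdef
  have hαr : (0 : ℝ) < α := hα0
  have hρ0 : 0 < ρ := by positivity
  have hρ2 : 1 < 2 * ρ := by
    have : (1 / 2 : ℝ) ^ (1 : ℝ) < ρ :=
      Real.rpow_lt_rpow_of_exponent_gt (by norm_num) (by norm_num) (by linarith)
    rw [Real.rpow_one] at this
    linarith
  have hq : 0 < 2 * ρ - 1 := by linarith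
  refine ⟨ρ⁻¹ + 2 * ρ / (2 * ρ - 1) * ρ⁻¹ + 1, by positivity, fun d hd0 hd1 => ?_⟩
  obtain ⟨N, hN1, hN2⟩ := exists_nat_pow_near_of_lt_one hd0 hd1 (by norm_num : (0 : ℝ) < 1 / 2)
    (by norm_num)
  refine ⟨N, hN2, ?_⟩
  have h1 : ρ ^ N ≤ ρ⁻¹ * d ^ (2 * α : ℝ) := by
    have : ρ ^ (N + 1) ≤ d ^ (2 * α : ℝ) := by
      rw [hρdef, ← half_rpow_pow]
      exact Real.rpow_le_rpow (by positivity) hN1.le (by positivity)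
    rw [inv_mul_eq_div, le_div_iff₀ hρ0, ← pow_succ]
    exact this
  have h2 : ∑ n ∈ Finset.range N, (2 * ρ) ^ (n + 1) ≤ 2 * ρ / (2 * ρ - 1) * (2 * ρ) ^ N := by
    have : ∑ n ∈ Finset.range N, (2 * ρ) ^ (n + 1) = 2 * ρ / (2 * ρ - 1) * ((2 * ρ) ^ N - 1) := by
      simp only [pow_succ]
      rw [← Finset.sum_mul, geom_sum_eq hρ2.ne']
      ring
    rw [this]
    gcongr
    linarith
  have h3 : d * (2 * ρ) ^ N ≤ ρ ^ N := by
    calc d * (2 * ρ) ^ N ≤ (1 / 2) ^ N * (2 * ρ) ^ N := by gcongr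
      _ = ρ ^ N := by
        rw [← mul_pow]
        congr 1
        ring
  have h4 : d ≤ d ^ (2 * α : ℝ) := by
    calc d = d ^ (1 : ℝ) := (Real.rpow_one d).symm
      _ ≤ _ := Real.rpow_le_rpow_of_exponent_ge hd0 hd1 (by linarith)
  have h5 : d * ∑ n ∈ Finset.range N, (2 * ρ) ^ (n + 1)
      ≤ 2 * ρ / (2 * ρ - 1) * (ρ⁻¹ * d ^ (2 * α : ℝ)) := by
    calc d * ∑ n ∈ Finset.range N, (2 * ρ) ^ (n + 1)
        ≤ d * (2 * ρ / (2 * ρ - 1) * (2 * ρ) ^ N) := by gcongr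
      _ = 2 * ρ / (2 * ρ - 1) * (d * (2 * ρ) ^ N) := by ring
      _ ≤ 2 * ρ / (2 * ρ - 1) * (ρ⁻¹ * d ^ (2 * α : ℝ)) :=
        mul_le_mul_of_nonneg_left (h3.trans h1) (by positivity)
  linarith

/-- The critical case `2ρ = 1`: the sum has `N` equal terms, with `N log 2 ≤ log(1/d)`. The
restriction `d ≤ 1/2` gives `log(1/d) ≥ log 2`, which absorbs the terms linear in `d`. -/
lemma exists_sum_le_mul_log : ∃ K : ℝ, 0 ≤ K ∧ ∀ d : ℝ, 0 < d → d ≤ 1 / 2 →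
    ∃ N : ℕ, d ≤ (1 / 2 : ℝ) ^ N ∧
      (1 / 2 : ℝ) ^ N + d * ∑ n ∈ Finset.range N, (2 * (1 / 2 : ℝ)) ^ (n + 1) + d
      ≤ K * (d * Real.log (1 / d)) := by
  have hl : 0 < Real.log 2 := Real.log_pos one_lt_two
  refine ⟨4 / Real.log 2, by positivity, fun d hd0 hd1 => ?_⟩
  obtain ⟨N, hN1, hN2⟩ := exists_nat_pow_near_of_lt_one hd0 (by linarith)
    (by norm_num : (0 : ℝ) < 1 / 2) (by norm_num)
  refine ⟨N, hN2, ?_⟩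
  have h1 : (1 / 2 : ℝ) ^ N ≤ 2 * d := by
    rw [pow_succ] at hN1
    linarith
  have h2 : N * Real.log 2 ≤ Real.log (1 / d) := by
    rw [← Real.log_pow]
    refine Real.log_le_log (by positivity) ?_
    rw [le_div_iff₀ hd0]
    calc (2 : ℝ) ^ N * d ≤ 2 ^ N * (1 / 2) ^ N := by gcongr
      _ = 1 := by
        rw [← mul_pow]
        norm_num
  have h3 : Real.log 2 ≤ Real.log (1 / d) := by
    refine Real.log_le_log (by norm_num) ?_
    rw [le_div_iff₀ hd0]
    linarith
  have h4 : (N + 3 : ℝ) * Real.log 2 ≤ 4 * Real.log (1 / d) := by linarith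
  have h5 : ∑ n ∈ Finset.range N, (2 * (1 / 2 : ℝ)) ^ (n + 1) = N := by
    norm_num
  rw [h5]
  calc (1 / 2 : ℝ) ^ N + d * N + d ≤ d * (N + 3) := by linarith
    _ ≤ d * (4 * Real.log (1 / d) / Real.log 2) := by
      gcongr
      rwa [le_div_iff₀ hl]
    _ = _ := by ring

/-- Here `2ρ < 1`: the series over all scales converges, and `ρ^N ≤ (1/2)^N ≤ 2d`. -/
lemma exists_sum_le_linear (hα : 1 / 2 < (α : ℝ)) : ∃ K : ℝ, 0 ≤ K ∧ ∀ d : ℝ, 0 < d →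
    d ≤ 1 → ∃ N : ℕ, d ≤ (1 / 2 : ℝ) ^ N ∧
      ((1 / 2 : ℝ) ^ (2 * α : ℝ)) ^ N
        + d * ∑ n ∈ Finset.range N, (2 * (1 / 2 : ℝ) ^ (2 * α : ℝ)) ^ (n + 1) + d ≤ K * d := by
  set ρ : ℝ := (1 / 2 : ℝ) ^ (2 * α : ℝ) with hρdef
  have hρ0 : 0 < ρ := by positivity
  have hρ2 : ρ < 1 / 2 := by
    have : ρ < (1 / 2 : ℝ) ^ (1 : ℝ) :=
      Real.rpow_lt_rpow_of_exponent_gt (by norm_num) (by norm_num) (by linarith)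
    rwa [Real.rpow_one] at this
  have hq : 0 < 1 - 2 * ρ := by linarith
  refine ⟨3 + (1 - 2 * ρ)⁻¹, by positivity, fun d hd0 hd1 => ?_⟩
  obtain ⟨N, hN1, hN2⟩ := exists_nat_pow_near_of_lt_one hd0 hd1 (by norm_num : (0 : ℝ) < 1 / 2)
    (by norm_num)
  refine ⟨N, hN2, ?_⟩
  have h1 : ρ ^ N ≤ 2 * d := by
    have h2 : ρ ^ N ≤ (1 / 2) ^ N := by gcongr
    rw [pow_succ] at hN1
    linarith
  have h2 : ∑ n ∈ Finset.range N, (2 * ρ) ^ (n + 1) ≤ (1 - 2 * ρ)⁻¹ := by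
    have h3 : ∑ n ∈ Finset.range N, (2 * ρ) ^ (n + 1) ≤ ∑ n ∈ Finset.range N, (2 * ρ) ^ n :=
      Finset.sum_le_sum fun n _ => pow_le_pow_of_le_one (by positivity) (by linarith) (Nat.le_succ n)
    refine h3.trans ?_
    rw [← tsum_geometric_of_lt_one (by positivity) (by linarith)]
    exact (summable_geometric_of_lt_one (by positivity) (by linarith)).sum_le_tsum _
      fun _ _ => by positivity
  have h3 : d * ∑ n ∈ Finset.range N, (2 * ρ) ^ (n + 1) ≤ (1 - 2 * ρ)⁻¹ * d := by
    rw [mul_comm d]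
    gcongr
  linarith

lemma HasDyadicModulus.supNorm_le {ρ B : ℝ} {P : E3 → ℝ} (hP : HasDyadicModulus ρ B P) :
    supNorm P ≤ ENNReal.ofReal B := by
  refine iSup_le fun x => ?_
  rw [Real.enorm_eq_ofReal_abs]
  exact ENNReal.ofReal_le_ofReal (hP.1 x)

lemma HasDyadicModulus.abs_sub_le_two_mul {ρ B : ℝ} {P : E3 → ℝ} (hP : HasDyadicModulus ρ B P)
    (x x' : E3) : |P x - P x'| ≤ 2 * B := by
  refine (abs_sub _ _).trans ?_
  linarith [hP.1 x, hP.1 x']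

lemma coe_toNNReal_mul_eq {K B : ℝ} (hK : 0 ≤ K) :
    ENNReal.ofReal B + ((K * B).toNNReal : ℝ≥0∞) = ((1 + K).toNNReal : ℝ≥0∞) * ENNReal.ofReal B := by
  change _ + ENNReal.ofReal _ = ENNReal.ofReal _ * _
  rw [ENNReal.ofReal_mul hK, ENNReal.ofReal_add zero_le_one hK, add_mul, ENNReal.ofReal_one, one_mul]

theorem exists_holderFullNorm_le (hα0 : 0 < α) (hα : α < 1 / 2) : ∃ K : ℝ≥0, ∀ (B : ℝ) (P : E3 → ℝ),
    0 ≤ B → HasDyadicModulus ((1 / 2 : ℝ) ^ (2 * α : ℝ)) B P →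
      holderFullNorm (2 * α) P ≤ K * ENNReal.ofReal B := by
  have hα' : (α : ℝ) < 1 / 2 := by exact_mod_cast hα
  have hα0' : (0 : ℝ) < α := hα0
  obtain ⟨K, hK0, hK⟩ := exists_sum_le_rpow hα0 hα'
  -- `K` serves distances at most `1`, the `2` comes from the bound `2B` on the oscillation at
  -- larger distances, and the `1` from the supremum norm.
  refine ⟨(1 + (K + 2)).toNNReal, fun B P hB hP => ?_⟩
  have key : ∀ x x', dist (P x) (P x') ≤ (K + 2) * B * dist x x' ^ (2 * α : ℝ) := by
    intro x x'
    rcases eq_or_ne x x' with rfl | hne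
    · rw [dist_self]
      positivity
    have hd0 : 0 < dist x x' := dist_pos.2 hne
    rw [Real.dist_eq]
    rcases le_total (dist x x') 1 with h1 | h1
    · obtain ⟨N, hN, hs⟩ := hK _ hd0 h1
      refine (hP.le_of_sum_le hB hN hs).trans ?_
      have : 0 ≤ B * dist x x' ^ (2 * α : ℝ) := by positivity
      linarith
    · have h2 : 1 ≤ dist x x' ^ (2 * α : ℝ) := Real.one_le_rpow h1 (by positivity)
      have h3 : (K + 2) * B * 1 ≤ (K + 2) * B * dist x x' ^ (2 * α : ℝ) := by gcongr
      have h4 := mul_nonneg hK0 hB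
      linarith [hP.abs_sub_le_two_mul x x']
  have hH : HolderWith ((K + 2) * B).toNNReal (2 * α) P := by
    intro x x'
    have h5 := ENNReal.ofReal_le_ofReal (key x x')
    rw [ENNReal.ofReal_mul (by positivity), ← ENNReal.ofReal_rpow_of_nonneg dist_nonneg
      (by positivity), ← edist_dist, ← edist_dist] at h5
    exact_mod_cast h5
  rw [← coe_toNNReal_mul_eq (by positivity)]
  exact add_le_add hP.supNorm_le hH.eHolderNorm_le

lemma iInf_coe_le {S : ℝ≥0 → Prop} {C : ℝ≥0} (hC : S C) :
    ⨅ (C : ℝ≥0) (_ : S C), (C : ℝ≥0∞) ≤ C :=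
  iInf₂_le (f := fun (C : ℝ≥0) (_ : S C) => (C : ℝ≥0∞)) C hC

theorem exists_lipFullNorm_le (hα : 1 / 2 < α) : ∃ K : ℝ≥0, ∀ (B : ℝ) (P : E3 → ℝ),
    0 ≤ B → HasDyadicModulus ((1 / 2 : ℝ) ^ (2 * α : ℝ)) B P →
      lipFullNorm P ≤ K * ENNReal.ofReal B := by
  have hα' : 1 / 2 < (α : ℝ) := by exact_mod_cast hα
  obtain ⟨K, hK0, hK⟩ := exists_sum_le_linear hα'
  refine ⟨(1 + (K + 2)).toNNReal, fun B P hB hP => ?_⟩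
  have key : ∀ x x', dist (P x) (P x') ≤ (K + 2) * B * dist x x' := by
    intro x x'
    rcases eq_or_ne x x' with rfl | hne
    · simp
    have hd0 : 0 < dist x x' := dist_pos.2 hne
    rw [Real.dist_eq]
    rcases le_total (dist x x') 1 with h1 | h1
    · obtain ⟨N, hN, hs⟩ := hK _ hd0 h1
      refine (hP.le_of_sum_le hB hN hs).trans ?_
      have : 0 ≤ B * dist x x' := by positivity
      linarith
    · have h3 : (K + 2) * B * 1 ≤ (K + 2) * B * dist x x' := by gcongr
      have h4 := mul_nonneg hK0 hB
      linarith [hP.abs_sub_le_two_mul x x']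
  have hH : LipschitzWith ((K + 2) * B).toNNReal P := LipschitzWith.of_dist_le_mul fun x x' => by
    rw [Real.coe_toNNReal _ (by positivity)]
    exact key x x'
  rw [← coe_toNNReal_mul_eq (by positivity)]
  exact add_le_add hP.supNorm_le (iInf_coe_le hH)

theorem exists_logLipFullNorm_le (hα : α = 1 / 2) : ∃ K : ℝ≥0, ∀ (B : ℝ) (P : E3 → ℝ),
    0 ≤ B → HasDyadicModulus ((1 / 2 : ℝ) ^ (2 * α : ℝ)) B P →
      logLipFullNorm P ≤ K * ENNReal.ofReal B := by
  obtain ⟨K, hK0, hK⟩ := exists_sum_le_mul_log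
  refine ⟨(1 + K).toNNReal, fun B P hB hP => ?_⟩
  have hρ : (1 / 2 : ℝ) ^ (2 * α : ℝ) = 1 / 2 := by
    rw [hα]
    norm_num
  rw [hρ] at hP
  have hH : LogLipschitzWith (K * B).toNNReal P := by
    intro x x' hd0 hd1
    rw [Real.coe_toNNReal _ (by positivity), Real.dist_eq]
    obtain ⟨N, hN, hs⟩ := hK _ hd0 hd1
    exact (hP.le_of_sum_le hB hN hs).trans (le_of_eq (by ring))
  rw [← coe_toNNReal_mul_eq hK0]
  exact add_le_add hP.supNorm_le (iInf_coe_le hH)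

end moduli

/-! ### Measurability in time of the norms -/

section normMeasurability

/-- The best constant is the supremum of the difference quotients, and continuity reduces it to a
dense set of pairs. With `D` countable, the infimum over constants becomes a countable supremum,
hence measurable in a parameter. -/
lemma iInf_modulus_eq_iSup {S D : Set (E3 × E3)} (hDS : D ⊆ S) (hSD : S ⊆ closure D)
    {m : E3 × E3 → ℝ} (hm : ContinuousOn m S) (hpos : ∀ z ∈ S, 0 < m z) {f : E3 → ℝ}
    (hf : Continuous f) :
    ⨅ (C : ℝ≥0) (_ : ∀ z ∈ S, dist (f z.1) (f z.2) ≤ C * m z), (C : ℝ≥0∞)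
      = ⨆ z : D, ENNReal.ofReal (dist (f z.1.1) (f z.1.2) / m z) := by
  apply le_antisymm
  · set s := ⨆ z : D, ENNReal.ofReal (dist (f z.1.1) (f z.1.2) / m z) with hs
    rcases eq_or_ne s ⊤ with h | h
    · rw [h]
      exact le_top
    · rw [← ENNReal.coe_toNNReal h]
      refine iInf_coe_le (S := fun C : ℝ≥0 => ∀ z ∈ S, dist (f z.1) (f z.2) ≤ C * m z) fun z hz => ?_
      refine ContinuousWithinAt.closure_le (s := D) (hSD hz) (f := fun z => dist (f z.1) (f z.2))
        (g := fun z => (s.toNNReal : ℝ) * m z) ?_ ?_ fun y hy => ?_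
      · exact Continuous.continuousWithinAt (by fun_prop)
      · exact ((hm z hz).mono hDS).const_mul _
      · have h1 : ENNReal.ofReal (dist (f y.1) (f y.2) / m y) ≤ s :=
          le_iSup (fun z : D => ENNReal.ofReal (dist (f z.1.1) (f z.1.2) / m z)) ⟨y, hy⟩
        rw [← div_le_iff₀ (hpos y (hDS hy))]
        exact (ENNReal.ofReal_le_iff_le_toReal h).1 h1
  · refine le_iInf₂ fun C hC => iSup_le fun z => ?_
    refine ENNReal.ofReal_le_of_le_toReal ?_
    rw [div_le_iff₀ (hpos _ (hDS z.2))]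
    exact hC _ (hDS z.2)

variable {Ω : Type*} [MeasurableSpace Ω] {μ : Measure Ω} {F : Ω → E3 → ℝ}

lemma aemeasurable_iInf_modulus (hF : ∀ x, AEMeasurable (fun t => F t x) μ)
    (hc : ∀ᵐ t ∂μ, Continuous (F t)) {S : Set (E3 × E3)} {m : E3 × E3 → ℝ}
    (hm : ContinuousOn m S) (hpos : ∀ z ∈ S, 0 < m z) :
    AEMeasurable (fun t => ⨅ (C : ℝ≥0) (_ : ∀ z ∈ S, dist (F t z.1) (F t z.2) ≤ C * m z),
      (C : ℝ≥0∞)) μ := by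
  obtain ⟨D, hDS, hD, hSD⟩ :=
    (TopologicalSpace.IsSeparable.of_separableSpace S).exists_countable_dense_subset
  have := hD.to_subtype
  have h1 : AEMeasurable (fun t => ⨆ z : D, ENNReal.ofReal (dist (F t z.1.1) (F t z.1.2) / m z)) μ :=
    AEMeasurable.iSup fun z => (((hF _).dist (hF _)).div_const _).ennreal_ofReal
  refine h1.congr ?_
  filter_upwards [hc] with t ht
  exact (iInf_modulus_eq_iSup hDS hSD hm hpos ht).symm

lemma aemeasurable_supNorm (hF : ∀ x, AEMeasurable (fun t => F t x) μ)
    (hc : ∀ᵐ t ∂μ, Continuous (F t)) : AEMeasurable (fun t => supNorm (F t)) μ := by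
  have h1 : AEMeasurable (fun t => ⨆ n : ℕ, ‖F t (TopologicalSpace.denseSeq E3 n)‖ₑ) μ :=
    AEMeasurable.iSup fun n => (hF _).enorm
  refine h1.congr ?_
  filter_upwards [hc] with t ht
  refine le_antisymm (iSup_le fun n => le_iSup (fun x => ‖F t x‖ₑ) _) (iSup_le fun x => ?_)
  refine (TopologicalSpace.denseRange_denseSeq E3).induction_on x
    (isClosed_le ht.enorm continuous_const) fun n => ?_
  exact le_iSup (fun n => ‖F t (TopologicalSpace.denseSeq E3 n)‖ₑ) n

lemma aemeasurable_holderFullNorm (hF : ∀ x, AEMeasurable (fun t => F t x) μ)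
    (hc : ∀ᵐ t ∂μ, Continuous (F t)) {γ : ℝ≥0} (hγ : 0 < γ) :
    AEMeasurable (fun t => holderFullNorm γ (F t)) μ := by
  refine (aemeasurable_supNorm hF hc).add ?_
  have h1 := aemeasurable_iInf_modulus hF hc (S := {z | z.1 ≠ z.2})
    (m := fun z => dist z.1 z.2 ^ (γ : ℝ))
    (Continuous.continuousOn (by
      exact (continuous_fst.dist continuous_snd).rpow_const fun _ => Or.inr γ.2))
    (fun z hz => Real.rpow_pos_of_pos (dist_pos.2 hz) _)
  refine h1.congr (Eventually.of_forall fun t => ?_)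
  simp only [eHolderNorm]
  refine iInf_congr fun C => iInf_congr_Prop ?_ fun _ => rfl
  have hγ' : (0 : ℝ) < γ := hγ
  constructor
  · intro h x y
    rcases eq_or_ne x y with rfl | hne
    · simp
    have h5 := ENNReal.ofReal_le_ofReal (h (x, y) hne)
    rw [ENNReal.ofReal_mul C.coe_nonneg, ← ENNReal.ofReal_rpow_of_nonneg dist_nonneg hγ'.le, ← edist_dist,
      ← edist_dist] at h5
    simpa using h5
  · intro h z _
    exact h.dist_le z.1 z.2

lemma aemeasurable_lipFullNorm (hF : ∀ x, AEMeasurable (fun t => F t x) μ)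
    (hc : ∀ᵐ t ∂μ, Continuous (F t)) : AEMeasurable (fun t => lipFullNorm (F t)) μ := by
  refine (aemeasurable_supNorm hF hc).add ?_
  have h1 := aemeasurable_iInf_modulus hF hc (S := {z | z.1 ≠ z.2}) (m := fun z => dist z.1 z.2)
    (Continuous.continuousOn (by fun_prop)) (fun z hz => dist_pos.2 hz)
  refine h1.congr (Eventually.of_forall fun t => ?_)
  refine iInf_congr fun C => iInf_congr_Prop ?_ fun _ => rfl
  constructor
  · intro h
    refine LipschitzWith.of_dist_le_mul fun x y => ?_
    rcases eq_or_ne x y with rfl | hne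
    · simp
    exact h (x, y) hne
  · intro h z _
    exact h.dist_le_mul z.1 z.2

lemma aemeasurable_logLipFullNorm (hF : ∀ x, AEMeasurable (fun t => F t x) μ)
    (hc : ∀ᵐ t ∂μ, Continuous (F t)) : AEMeasurable (fun t => logLipFullNorm (F t)) μ := by
  refine (aemeasurable_supNorm hF hc).add ?_
  have h1 := aemeasurable_iInf_modulus hF hc
    (S := {z | 0 < dist z.1 z.2 ∧ dist z.1 z.2 ≤ 1 / 2})
    (m := fun z => dist z.1 z.2 * Real.log (1 / dist z.1 z.2)) ?_ ?_
  · refine h1.congr (Eventually.of_forall fun t => ?_)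
    refine iInf_congr fun C => iInf_congr_Prop ?_ fun _ => rfl
    exact ⟨fun h x y h2 h3 => h (x, y) ⟨h2, h3⟩, fun h z hz => h z.1 z.2 hz.1 hz.2⟩
  · have hd : ContinuousOn (fun z : E3 × E3 => dist z.1 z.2)
        {z | 0 < dist z.1 z.2 ∧ dist z.1 z.2 ≤ 1 / 2} :=
      (continuous_fst.dist continuous_snd).continuousOn
    exact hd.mul ((continuousOn_const.div hd fun z hz => hz.1.ne').log fun z hz =>
      (one_div_pos.2 hz.1).ne')
  · intro z hz
    refine mul_pos hz.1 (Real.log_pos ?_)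
    rw [lt_div_iff₀ hz.1]
    linarith [hz.2]

end normMeasurability

/-! ### Continuity in the centre, and the increment identity -/

section fixedTime

variable {Ψ : E3 → ℝ} {h : ℝ → ℝ} {v : E3 → E3} {p : E3 → ℝ}

lemma continuous_integral_comp_sub {X : Type*} [TopologicalSpace X] [FirstCountableTopology X]
    [LocallyCompactSpace X]
    {f : X → E3 → ℝ} (hf : Continuous (Function.uncurry f)) {R : ℝ}
    (h0 : ∀ x z, R < ‖z‖ → f x z = 0) : Continuous fun x => ∫ z, f x z := by
  have h1 : ∀ x, ∫ z, f x z = ∫ z in Metric.closedBall (0 : E3) R, f x z := fun x =>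
    (setIntegral_eq_integral_of_forall_compl_eq_zero fun z hz => h0 x z (by
      simpa using hz)).symm
  simp only [h1]
  exact continuous_parametric_integral_of_continuous hf (isCompact_closedBall _ _)

/-- After translation by the centre the integrand is supported in a fixed ball, so continuity of
parametric integrals over compact sets applies. -/
lemma continuous_integral_hessian_apply (hΨ : ContDiff ℝ ∞ Ψ) (hΨ0 : ∀ z, 2 ≤ ‖z‖ → Ψ z = 0)
    {r : ℝ} (hr : 0 < r) (hv : Continuous v) :
    Continuous fun q : E3 × E3 => ∫ y, fderiv ℝ (fderiv ℝ Ψ) (r⁻¹ • (y - q.1)) (v y) q.2 := by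
  have h1 : ∀ q : E3 × E3, ∫ y, fderiv ℝ (fderiv ℝ Ψ) (r⁻¹ • (y - q.1)) (v y) q.2
      = ∫ z, fderiv ℝ (fderiv ℝ Ψ) (r⁻¹ • z) (v (z + q.1)) q.2 := by
    intro q
    rw [← integral_add_right_eq_self _ q.1]
    simp only [add_sub_cancel_right]
  simp only [h1]
  have hH := (contDiff_fderiv (contDiff_fderiv hΨ)).continuous
  refine continuous_integral_comp_sub
    (f := fun (q : E3 × E3) z => fderiv ℝ (fderiv ℝ Ψ) (r⁻¹ • z) (v (z + q.1)) q.2) (R := 2 * r)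
    ?_ fun q z hz => ?_
  · exact ((hH.comp (by fun_prop)).clm_apply (by fun_prop)).clm_apply (by fun_prop)
  · have := hessian_scaled_eq_zero hΨ0 hr (x := 0) (y := z) (by simpa using hz)
    rw [sub_zero] at this
    simp [this]

lemma continuous_quadMean (hΨ : ContDiff ℝ ∞ Ψ) (hΨ0 : ∀ z, 2 ≤ ‖z‖ → Ψ z = 0)
    {r : ℝ} (hr : 0 < r) (hv : Continuous v) : Continuous (quadMean Ψ v r) := by
  have h1 : ∀ x : E3, ∫ y, fderiv ℝ (fderiv ℝ Ψ) (r⁻¹ • (y - x)) (v y) (v y)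
      = ∫ z, fderiv ℝ (fderiv ℝ Ψ) (r⁻¹ • z) (v (z + x)) (v (z + x)) := by
    intro x
    rw [← integral_add_right_eq_self _ x]
    simp only [add_sub_cancel_right]
  unfold quadMean
  simp only [h1]
  have hH := (contDiff_fderiv (contDiff_fderiv hΨ)).continuous
  refine continuous_const.mul (continuous_integral_comp_sub
    (f := fun (x : E3) z => fderiv ℝ (fderiv ℝ Ψ) (r⁻¹ • z) (v (z + x)) (v (z + x))) (R := 2 * r)
    ?_ fun x z hz => ?_)
  · exact ((hH.comp (by fun_prop)).clm_apply (by fun_prop)).clm_apply (by fun_prop)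
  · have := hessian_scaled_eq_zero hΨ0 hr (x := 0) (y := z) (by simpa using hz)
    rw [sub_zero] at this
    simp [this]

lemma hasCompactSupport_radial (h1 : ∀ r, 1 ≤ r → h r = 0) {r : ℝ} (hr : 0 < r) (x : E3) :
    HasCompactSupport fun y : E3 => h (‖y - x‖ / r) := by
  refine HasCompactSupport.intro (isCompact_closedBall x r) fun y hy => h1 _ ?_
  rw [Metric.mem_closedBall, dist_eq_norm, not_le] at hy
  exact (one_le_div hr).2 hy.le

lemma continuous_radialMean (hh : Continuous h) (h1 : ∀ r, 1 ≤ r → h r = 0)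
    (hp : LocallyIntegrable p) {r : ℝ} (hr : 0 < r) : Continuous (radialMean h p r) := by
  have h2 := hasCompactSupport_radial h1 hr 0
  simp only [sub_zero] at h2
  have h3 := h2.continuous_convolution_right (ContinuousLinearMap.mul ℝ ℝ) hp
    (hh.comp (continuous_norm.div_const r))
  refine continuous_const.mul (h3.congr fun x => ?_)
  simp only [convolution, ContinuousLinearMap.mul_apply']
  refine integral_congr_ae (Eventually.of_forall fun y => ?_)
  simp only
  rw [norm_sub_rev, mul_comm]

lemma integrable_radial_mul (hh : Continuous h) (h1 : ∀ r, 1 ≤ r → h r = 0)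
    (hp : LocallyIntegrable p) {r : ℝ} (hr : 0 < r) (x : E3) :
    Integrable fun y => h (‖y - x‖ / r) * p y :=
  hp.integrable_smul_left_of_hasCompactSupport (by fun_prop) (hasCompactSupport_radial h1 hr x)

lemma lap_comp_smul_sub (hΨ : ContDiff ℝ ∞ Ψ) (c : ℝ) (x y : E3) :
    lap (fun y => Ψ (c • (y - x))) y = c ^ 2 * lap Ψ (c • (y - x)) := by
  simp only [lap, hessian_comp_smul_sub hΨ, Finset.mul_sum]
  rfl

lemma radialMean_sub_eq (hΨ : ContDiff ℝ ∞ Ψ) (hΨ0 : ∀ z, 2 ≤ ‖z‖ → Ψ z = 0) (hh : Continuous h)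
    (h1 : ∀ r, 1 ≤ r → h r = 0) (hlap : ∀ z, lap Ψ z = h ‖z‖ - h (‖z‖ / 2) / 8)
    (hv : Continuous v) (hp : LocallyIntegrable p) {r : ℝ} (hr : 0 < r) (x : E3)
    (heq : ∫ y, (fderiv ℝ (fderiv ℝ fun y => Ψ (r⁻¹ • (y - x))) y (v y) (v y)
      + p y * lap (fun y => Ψ (r⁻¹ • (y - x))) y) = 0) :
    radialMean h p r x - radialMean h p (2 * r) x = - quadMean Ψ v r x := by
  have i1 := integrable_hessian_quadratic hΨ hΨ0 hr hv x
  have i2 := integrable_radial_mul hh h1 hp hr x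
  have i3 := integrable_radial_mul hh h1 hp (by positivity : 0 < 2 * r) x
  have i4 : Integrable fun y => fderiv ℝ (fderiv ℝ Ψ) (r⁻¹ • (y - x)) (v y) (v y)
      + h (‖y - x‖ / r) * p y := i1.add i2
  have e : ∀ y, fderiv ℝ (fderiv ℝ fun y => Ψ (r⁻¹ • (y - x))) y (v y) (v y)
      + p y * lap (fun y => Ψ (r⁻¹ • (y - x))) y
      = (r⁻¹) ^ 2 * (fderiv ℝ (fderiv ℝ Ψ) (r⁻¹ • (y - x)) (v y) (v y)
        + h (‖y - x‖ / r) * p y - 1 / 8 * (h (‖y - x‖ / (2 * r)) * p y)) := by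
    intro y
    rw [hessian_comp_smul_sub hΨ, lap_comp_smul_sub hΨ, hlap, norm_smul, norm_inv, Real.norm_eq_abs,
      abs_of_pos hr, inv_mul_eq_div, div_div, mul_comm r 2]
    change (r⁻¹) ^ 2 * fderiv ℝ (fderiv ℝ Ψ) (r⁻¹ • (y - x)) (v y) (v y) + _ = _
    ring
  simp only [e] at heq
  rw [integral_const_mul, integral_sub i4 (i3.const_mul _), integral_add i1 i2,
    integral_const_mul] at heq
  have h2 := (mul_eq_zero.1 heq).resolve_left (by positivity)
  simp only [radialMean, quadMean]
  have h3 : ((2 * r) ^ 3)⁻¹ = (r ^ 3)⁻¹ * (1 / 8) := by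
    rw [mul_pow, mul_inv]
    norm_num
    ring
  rw [h3]
  linear_combination (r ^ 3)⁻¹ * h2

end fixedTime

/-! ### One null set of times for all centres and scales -/

section sections

variable {ν T : ℝ} {u : ℝ → E3 → E3} {p : ℝ → E3 → ℝ}

lemma SliceIntegrable.ae_integrable {f : ℝ → E3 → ℝ} (hf : SliceIntegrable T f) :
    ∀ᵐ t ∂(volume.restrict (Ioo 0 T)), Integrable (f t) := by
  -- Integrability is known only over compact sets of times, so the open interval is exhausted by
  -- countably many of them.
  have hsub : Ioo 0 T ⊆ ⋃ n : ℕ, Icc (1 / ((n : ℝ) + 1)) (T - 1 / ((n : ℝ) + 1)) := by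
    intro t ht
    have hlim := tendsto_one_div_add_atTop_nhds_zero_nat (𝕜 := ℝ)
    have h1 := hlim.eventually_lt_const ht.1
    have h2 := hlim.eventually_lt_const (sub_pos.2 ht.2)
    obtain ⟨n, hn1, hn2⟩ := (h1.and h2).exists
    exact mem_iUnion.2 ⟨n, hn1.le, by linarith⟩
  refine ae_restrict_of_ae_restrict_of_subset hsub ((ae_restrict_iUnion_iff _ _).2 fun n => ?_)
  have hn : 0 < 1 / ((n : ℝ) + 1) := by positivity
  have h := hf (Icc (1 / ((n : ℝ) + 1)) (T - 1 / ((n : ℝ) + 1)))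
    (fun t ht => ⟨hn.trans_le ht.1, by linarith [ht.2]⟩) isCompact_Icc
  rw [IntegrableOn, Measure.volume_eq_prod, ← Measure.prod_restrict, Measure.restrict_univ] at h
  exact h.prod_right_ae

lemma ae_locallyIntegrable (hp : LocallyIntegrableOn (Function.uncurry p) (slab T) volume) :
    ∀ᵐ t ∂(volume.restrict (Ioo 0 T)), LocallyIntegrable (p t) := by
  have h1 : ∀ m : ℕ, ∀ᵐ t ∂(volume.restrict (Ioo 0 T)),
      IntegrableOn (p t) (Metric.closedBall (0 : E3) m) := by
    intro m
    have hs : SliceIntegrable T fun t => (Metric.closedBall (0 : E3) m).indicator (p t) := by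
      refine sliceIntegrable_of_compact (K := Metric.closedBall (0 : E3) m)
        (fun t y hy => indicator_of_notMem hy _) fun J hJ hc => ?_
      refine (hp.integrableOn_compact_subset (prod_mono hJ (subset_univ _))
        (hc.prod (isCompact_closedBall _ _))).congr_fun ?_
        (hc.measurableSet.prod measurableSet_closedBall)
      rintro ⟨t, y⟩ ⟨-, hy⟩
      exact (indicator_of_mem hy (p t)).symm
    filter_upwards [hs.ae_integrable] with t ht
    exact (integrable_indicator_iff measurableSet_closedBall).1 ht
  filter_upwards [ae_all_iff.2 h1] with t ht
  refine locallyIntegrable_iff.2 fun K hK => ?_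
  obtain ⟨R, hR⟩ := hK.isBounded.subset_closedBall (0 : E3)
  obtain ⟨m, hm⟩ := exists_nat_ge R
  exact (ht m).mono_set (hR.trans (Metric.closedBall_subset_closedBall hm))

variable {Ψ : E3 → ℝ} {h : ℝ → ℝ}

/-- Each test function has its own exceptional null set of times. Dyadic scales and a dense sequence
of pairs `(x, a)` keep these countable in number; continuity in `(x, a)`, available for the
continuous representative `v`, gives the rest. -/
lemma IsNavierStokesSolution.ae_integral_hessian_apply (hsol : IsNavierStokesSolution ν T u p)
    (hΨ : ContDiff ℝ ∞ Ψ) (hΨ0 : ∀ z, 2 ≤ ‖z‖ → Ψ z = 0) :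
    ∀ᵐ t ∂(volume.restrict (Ioo 0 T)), ∀ v : E3 → E3, Continuous v → v =ᵐ[volume] u t →
      ∀ (k : ℤ) (x a : E3),
        ∫ y, fderiv ℝ (fderiv ℝ Ψ) (((2 : ℝ) ^ k)⁻¹ • (y - x)) (v y) a = 0 := by
  have hk : ∀ k : ℤ, (((2 : ℝ) ^ k)⁻¹) ≠ 0 := fun k => by positivity
  have h1 : ∀ (k : ℤ) (n : ℕ), ∀ᵐ t ∂(volume.restrict (Ioo 0 T)),
      ∫ y, fderiv ℝ (fderiv ℝ Ψ)
        (((2 : ℝ) ^ k)⁻¹ • (y - (TopologicalSpace.denseSeq (E3 × E3) n).1)) (u t y)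
        (TopologicalSpace.denseSeq (E3 × E3) n).2 = 0 := by
    intro k n
    filter_upwards [hsol.ae_integral_fderiv (contDiff_test hΨ _ _ _)
      (hasCompactSupport_test hΨ0 (hk k) _ _)] with t ht
    simp only [fderiv_test hΨ] at ht
    rw [integral_const_mul] at ht
    exact (mul_eq_zero.1 ht).resolve_left (hk k)
  filter_upwards [ae_all_iff.2 fun k => ae_all_iff.2 (h1 k)] with t ht v hv hvu k x a
  have hcont := continuous_integral_hessian_apply hΨ hΨ0 (by positivity : 0 < (2 : ℝ) ^ k) hv
  refine congrFun ((TopologicalSpace.denseRange_denseSeq (E3 × E3)).equalizer hcont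
    (continuous_const (y := (0 : ℝ))) (funext fun n => ?_)) (x, a)
  simp only [Function.comp_apply]
  rw [← ht k n]
  refine integral_congr_ae ?_
  filter_upwards [hvu] with y hy
  rw [hy]

lemma IsNavierStokesSolution.ae_radialMean_sub (hsol : IsNavierStokesSolution ν T u p)
    (hΨ : ContDiff ℝ ∞ Ψ) (hΨ0 : ∀ z, 2 ≤ ‖z‖ → Ψ z = 0) (hh : Continuous h)
    (h1 : ∀ r, 1 ≤ r → h r = 0) (hlap : ∀ z, lap Ψ z = h ‖z‖ - h (‖z‖ / 2) / 8) :
    ∀ᵐ t ∂(volume.restrict (Ioo 0 T)), ∀ v : E3 → E3, Continuous v → v =ᵐ[volume] u t →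
      ∀ (k : ℤ) (x : E3), radialMean h (p t) ((2 : ℝ) ^ k) x
        - radialMean h (p t) (2 * (2 : ℝ) ^ k) x = - quadMean Ψ v ((2 : ℝ) ^ k) x := by
  have hk : ∀ k : ℤ, (((2 : ℝ) ^ k)⁻¹) ≠ 0 := fun k => by positivity
  have h2 := fun (k : ℤ) (n : ℕ) => hsol.ae_integral_hessian
    (contDiff_comp_smul_sub hΨ ((2 : ℝ) ^ k)⁻¹ (TopologicalSpace.denseSeq E3 n))
    (hasCompactSupport_comp_smul_sub (hasCompactSupport_of_two_le hΨ0) (hk k) _)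
  filter_upwards [ae_all_iff.2 fun k => ae_all_iff.2 (h2 k),
    ae_locallyIntegrable hsol.pressure_locally_integrable] with t ht hp v hv hvu k
  have hr : 0 < (2 : ℝ) ^ k := by positivity
  refine congrFun ((TopologicalSpace.denseRange_denseSeq E3).equalizer
    (f := TopologicalSpace.denseSeq E3)
    ((continuous_radialMean hh h1 hp hr).sub (continuous_radialMean hh h1 hp (by positivity)))
    (continuous_quadMean hΨ hΨ0 hr hv).neg (funext fun n => ?_))
  refine radialMean_sub_eq hΨ hΨ0 hh h1 hlap hv hp hr _ ?_
  rw [← ht k n]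
  refine integral_congr_ae ?_
  filter_upwards [hvu] with y hy
  rw [hy]

lemma aemeasurable_radialMean (hp : LocallyIntegrableOn (Function.uncurry p) (slab T) volume)
    (hh : Continuous h) (r : ℝ) (x : E3) :
    AEMeasurable (fun t => radialMean h (p t) r x) (volume.restrict (Ioo 0 T)) := by
  have h1 := hp.aestronglyMeasurable
  rw [volume_restrict_slab] at h1
  have h2 : AEStronglyMeasurable (fun z : ℝ × E3 => h (‖z.2 - x‖ / r) * p z.1 z.2)
      ((volume.restrict (Ioo 0 T)).prod volume) :=
    AEStronglyMeasurable.mul (Continuous.aestronglyMeasurable (by fun_prop)) h1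
  exact (h2.integral_prod_right').aemeasurable.const_mul _

end sections

/-! ### Integration in time and conclusion -/

lemma HasDyadicModulus.continuous {ρ B : ℝ} {P : E3 → ℝ} (hP : HasDyadicModulus ρ B P)
    (hB : 0 ≤ B) (hρ0 : 0 ≤ ρ) (hρ : ρ < 1) : Continuous P := by
  rw [continuous_iff_continuousAt]
  intro x
  rw [ContinuousAt, Metric.tendsto_nhds]
  intro ε hε
  obtain ⟨N, hN⟩ := exists_pow_lt_of_lt_one (show 0 < ε / (B + 1) / 2 by positivity) hρ
  set S := ∑ n ∈ Finset.range N, (2 * ρ) ^ (n + 1)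
  have hS : 0 ≤ S := Finset.sum_nonneg fun _ _ => by positivity
  set δ := min ((1 / 2 : ℝ) ^ N) (ε / (B + 1) / 2 / (S + 1))
  have hδ : 0 < δ := lt_min (by positivity) (by positivity)
  filter_upwards [Metric.ball_mem_nhds x hδ] with y hy
  have hy' : dist y x < δ := hy
  have h1 : dist y x ≤ ε / (B + 1) / 2 / (S + 1) := hy'.le.trans (min_le_right _ _)
  have h2 := hP.2 y x N (hy'.le.trans (min_le_left _ _))
  rw [le_div_iff₀ (by positivity)] at h1
  have h3 : ρ ^ N + dist y x * S + dist y x < ε / (B + 1) := by linarith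
  rw [Real.dist_eq]
  rw [lt_div_iff₀ (by positivity)] at h3
  have h4 : 0 ≤ ρ ^ N + dist y x * S + dist y x := by positivity
  nlinarith

lemma memLp_sq_add_const {Ω : Type*} [MeasurableSpace Ω] {μ : Measure Ω} [IsFiniteMeasure μ]
    {X : Ω → ℝ≥0∞} {q : ℝ≥0∞} (hX : MemLp X (2 * q) μ) {b : ℝ≥0∞} (hb : b ≠ ⊤) :
    MemLp (fun t => X t ^ 2 + b) q μ := by
  have h1 := hX.enorm_rpow_div 2
  have h2 : 2 * q / 2 = q := by
    rw [mul_comm]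
    exact ENNReal.mul_div_cancel_right two_ne_zero ENNReal.ofNat_ne_top
  rw [h2] at h1
  have h3 : MemLp (fun t => X t ^ 2) q μ := by simpa using h1
  exact h3.add (memLp_const_enorm (by simpa using hb))

/-- The time integrability of the pressure in any norm `N` that is controlled by the dyadic
modulus. -/
theorem IsNavierStokesSolution.memTimeLp_pressure {ν T : ℝ} {u : ℝ → E3 → E3} {p : ℝ → E3 → ℝ}
    (hsol : IsNavierStokesSolution ν T u p) (hp : PressureVanishesAtInfinity T p)
    {q : ℝ≥0∞} (hq : 1 ≤ q) {α : ℝ≥0} (hα : 0 < α) (hα1 : α ≤ 1)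
    (henergy : MemTimeLp (fun f : E3 → E3 => eLpNorm f 2 volume) ∞ T u)
    (hholder : MemTimeLp (fun f : E3 → E3 => holderFullNorm α f) (2 * q) T u)
    {N : (E3 → ℝ) → ℝ≥0∞}
    (hmeas : ∀ F : ℝ → E3 → ℝ, (∀ x, AEMeasurable (fun t => F t x) (volume.restrict (Ioo 0 T))) →
      (∀ᵐ t ∂(volume.restrict (Ioo 0 T)), Continuous (F t)) →
      AEMeasurable (fun t => N (F t)) (volume.restrict (Ioo 0 T)))
    {K : ℝ≥0} (hN : ∀ (B : ℝ) (P : E3 → ℝ), 0 ≤ B →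
      HasDyadicModulus ((1 / 2 : ℝ) ^ (2 * α : ℝ)) B P → N P ≤ K * ENNReal.ofReal B) :
    MemTimeLp N q T p := by
  obtain ⟨Ψ, h, hΨ, hΨ0, hh, h1, hlap, hc⟩ := exists_kernel
  obtain ⟨C, hC⟩ := exists_hasDyadicModulus hΨ hΨ0 hh h1 hc hα hα1
  obtain ⟨g, hgu, hgX⟩ := hholder
  obtain ⟨g', hgu', hgY⟩ := henergy
  set c := ∫ z : E3, h ‖z‖
  -- The representative of the pressure is defined by a formula valid at all times, not by choosing
  -- a `P` for each `t`: as an almost everywhere limit of measurable means it is measurable in `t`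
  -- at every `x`.
  set F : ℝ → E3 → ℝ := fun t x =>
    limUnder atTop fun n : ℕ => c⁻¹ * radialMean h (p t) ((1 / 2 : ℝ) ^ n) x
  have hαr : (0 : ℝ) < α := hα
  obtain ⟨b, hb, hYb⟩ : ∃ b : ℝ≥0∞, b ≠ ⊤ ∧
      ∀ᵐ t ∂(volume.restrict (Ioo 0 T)), eLpNorm (g' t) 2 volume ≤ b := by
    refine ⟨eLpNormEssSup (fun t => eLpNorm (g' t) 2 volume) (volume.restrict (Ioo 0 T)), ?_, ?_⟩
    · have := hgY.2
      rw [eLpNorm_exponent_top] at this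
      exact this.ne
    · filter_upwards [enorm_ae_le_eLpNormEssSup (fun t => eLpNorm (g' t) 2 volume)
        (volume.restrict (Ioo 0 T))] with t ht
      simpa using ht
  have hXfin : ∀ᵐ t ∂(volume.restrict (Ioo 0 T)), holderFullNorm α (g t) < ⊤ := by
    have h2 : 1 ≤ 2 * q := hq.trans (le_mul_of_one_le_left' one_le_two)
    have h3 := (hgX.mono_exponent h2).2
    rw [eLpNorm_one_eq_lintegral_enorm] at h3
    exact ae_lt_top' hgX.1.aemeasurable h3.ne
  have key : ∀ᵐ t ∂(volume.restrict (Ioo 0 T)),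
      (∀ x, Tendsto (fun n : ℕ => c⁻¹ * radialMean h (p t) ((1 / 2 : ℝ) ^ n) x) atTop
        (𝓝 (F t x))) ∧ F t =ᵐ[volume] p t ∧ Continuous (F t) ∧
        N (F t) ≤ (K * C : ℝ≥0) * (holderFullNorm α (g t) ^ 2 + b ^ 2) := by
    filter_upwards [hgu, hgu', hYb, hXfin, hp, ae_locallyIntegrable hsol.pressure_locally_integrable,
      hsol.ae_integral_hessian_apply hΨ hΨ0, hsol.ae_radialMean_sub hΨ hΨ0 hh.continuous h1 hlap]
      with t hgt hgt' hY hX hlim hpt hdiv hid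
    have hmem : MemHolder α (g t) := eHolderNorm_lt_top.1 (lt_of_le_of_lt le_add_self hX)
    have hH := hmem.holderWith
    have hcont := hH.continuous hα
    -- The energy and Hölder hypotheses come with different representatives `g'` and `g` of `u`; the
    -- `L²` norm does not distinguish them.
    have hY' : eLpNorm (g t) 2 volume ≤ b := by
      rw [eLpNorm_congr_ae (hgt.trans hgt'.symm)]
      exact hY
    have hLp : MemLp (g t) 2 volume :=
      ⟨hcont.aestronglyMeasurable, hY'.trans_lt (lt_top_iff_ne_top.2 hb)⟩
    have hint := (memLp_two_iff_integrable_sq_norm hcont.aestronglyMeasurable).1 hLp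
    obtain ⟨P, hP1, hP2, hP3⟩ := hC (g t) (p t) _ hH hint hpt (hdiv _ hcont hgt)
      (hid _ hcont hgt) hlim
    have hFP : F t = P := funext fun x => (hP1 x).limUnder_eq
    have hB : (0 : ℝ) ≤ C * ((nnHolderNorm α (g t) : ℝ) ^ 2 + ∫ y, ‖g t y‖ ^ 2) :=
      mul_nonneg C.coe_nonneg (add_nonneg (by positivity) (integral_nonneg fun _ => by positivity))
    rw [hFP]
    refine ⟨hP1, hP2, hP3.continuous hB (by positivity)
      (Real.rpow_lt_one (by norm_num) (by norm_num) (by positivity)), (hN _ P hB hP3).trans ?_⟩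
    rw [ENNReal.ofReal_mul C.coe_nonneg, ENNReal.ofReal_coe_nnreal, ← mul_assoc, ENNReal.coe_mul,
      ENNReal.ofReal_add (by positivity) (integral_nonneg fun _ => by positivity),
      ENNReal.ofReal_pow NNReal.zero_le_coe, ENNReal.ofReal_coe_nnreal]
    have e1 : (nnHolderNorm α (g t) : ℝ≥0∞) ≤ holderFullNorm α (g t) :=
      coe_nnHolderNorm_le_eHolderNorm.trans le_add_self
    have e2 : ENNReal.ofReal (∫ y, ‖g t y‖ ^ 2) ≤ b ^ 2 := by
      rw [ofReal_integral_eq_lintegral_ofReal hint (Eventually.of_forall fun _ => by positivity)]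
      have e3 := eLpNorm_nnreal_pow_eq_lintegral (f := g t) (μ := volume) (p := 2) two_ne_zero
      have e4 : ∫⁻ y, ENNReal.ofReal (‖g t y‖ ^ 2) = eLpNorm (g t) 2 volume ^ 2 := by
        calc ∫⁻ y, ENNReal.ofReal (‖g t y‖ ^ 2) = ∫⁻ y, ‖g t y‖ₑ ^ ((2 : ℝ≥0) : ℝ) := by
              refine lintegral_congr fun y => ?_
              rw [ENNReal.ofReal_pow (norm_nonneg _), ofReal_norm]
              simp
          _ = eLpNorm (g t) ((2 : ℝ≥0) : ℝ≥0∞) volume ^ ((2 : ℝ≥0) : ℝ) := e3.symm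
          _ = eLpNorm (g t) 2 volume ^ 2 := by simp
      rw [e4]
      gcongr
    gcongr
  refine ⟨F, key.mono fun t ht => ht.2.1, ?_⟩
  have hFm : ∀ x, AEMeasurable (fun t => F t x) (volume.restrict (Ioo 0 T)) := fun x =>
    aemeasurable_of_tendsto_metrizable_ae atTop
      (fun n => (aemeasurable_radialMean hsol.pressure_locally_integrable hh.continuous
        ((1 / 2 : ℝ) ^ n) x).const_mul c⁻¹) (key.mono fun t ht => ht.1 x)
  have hFN := hmeas F hFm (key.mono fun t ht => ht.2.2.1)
  refine (memLp_sq_add_const hgX (ENNReal.pow_ne_top hb (n := 2))).of_enorm_le_mul (c := K * C)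
    hFN.aestronglyMeasurable ?_
  filter_upwards [key] with t ht
  simpa using ht.2.2.2

theorem mainTheorem2 (ν T : ℝ) (hν : 0 < ν) (hT : 0 < T)
    (u : ℝ → E3 → E3) (p : ℝ → E3 → ℝ)
    (hsol : IsNavierStokesSolution ν T u p)
    (hp : PressureVanishesAtInfinity T p)
    (q : ℝ≥0∞) (hq : 1 ≤ q) (α : ℝ≥0) (hα : 0 < α) (hα1 : α ≤ 1)
    (henergy : MemTimeLp (fun f : E3 → E3 => eLpNorm f 2 volume) ∞ T u)
    (hholder : MemTimeLp (fun f : E3 → E3 => holderFullNorm α f) (2 * q) T u) :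
    (α < 1 / 2 → MemTimeLp (fun f : E3 → ℝ => holderFullNorm (2 * α) f) q T p) ∧
    (α = 1 / 2 → MemTimeLp (fun f : E3 → ℝ => logLipFullNorm f) q T p) ∧
    (1 / 2 < α → MemTimeLp (fun f : E3 → ℝ => lipFullNorm f) q T p) := by
  refine ⟨fun h => ?_, fun h => ?_, fun h => ?_⟩
  · obtain ⟨K, hK⟩ := exists_holderFullNorm_le hα h
    exact hsol.memTimeLp_pressure hp hq hα hα1 henergy hholder
      (fun F h1 h2 => aemeasurable_holderFullNorm h1 h2 (by positivity)) hK
  · obtain ⟨K, hK⟩ := exists_logLipFullNorm_le h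
    exact hsol.memTimeLp_pressure hp hq hα hα1 henergy hholder
      (fun F h1 h2 => aemeasurable_logLipFullNorm h1 h2) hK
  · obtain ⟨K, hK⟩ := exists_lipFullNorm_le h
    exact hsol.memTimeLp_pressure hp hq hα hα1 henergy hholder
      (fun F h1 h2 => aemeasurable_lipFullNorm h1 h2) hK
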